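/- Let $K$ be a field. A signed permutation of size $n$ is a permutation $\tau=\tau(1)\cdots\tau(n)$ of $[n]$, written as a word, together with a sign $\pm$ attached to each of its values. Let $\mathrm{FQSym}_\pm$ be the associative unital $K$-algebra with basis $(\mathbb F_\tau)$ indexed by all signed permutations of all sizes $n\ge 0$ and with product $\mathbb F_\tau\cdot\mathbb F_{\tau'}=\sum_\sigma \mathbb F_\sigma$, where, for $\tau$ of size $n$, $\sigma$ runs over all shuffles of the word $\tau$ with the word obtained from $\tau'$ by adding $n$ to all its values (signs travel with values). It is graded by the size of signed permutations. A Cambrian tree on $n\ge 0$ vertices is a directed tree $T$ with vertex set $[n]$ together with a sign $\varepsilon_v\in\{+,-\}$ for each vertex $v$, such that each negative vertex $v$ has at most one parent, at most one left child and at most one right child, each positive vertex $v$ has at most one child, at most one left parent and at most one right parent, and all labels in the subtree attached to a left (resp. right) child of a negative vertex $v$, or to a left (resp. right) parent of a positive vertex $v$, are smaller (resp. larger) than $v$ (unoccupied places are leaves; an arc goes from the child to the parent; the empty tree is allowed). A linear extension of $T$ is a signed permutation of $[n]$ in which each value $v$ has sign $\varepsilon_v$ and in which $i$ appears before $j$ for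 every arc $i\to j$ of $T$. Put $\mathbb P_T=\sum_\tau\mathbb F_\tau$, where $\tau$ runs over the linear extensions of $T$, and let the Cambrian algebra $\mathrm{Camb}\subseteq\mathrm{FQSym}_\pm$ be the linear span of the elements $\mathbb P_T$ for all Cambrian trees $T$. Then $\mathrm{Camb}$ is a unital subalgebra of $\mathrm{FQSym}_\pm$, and it is a free associative algebra. More precisely, it is freely generated, as a unital associative $K$-algebra, by a family of homogeneous elements that has exactly $2^n C_{n-1}$ members of degree $n$ for each $n\ge 1$ and none of degree $0$, where $C_m=\frac{1}{m+1}\binom{2m}{m}$ is the $m$-th Catalan number. -/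

import Mathlib

namespace Cambrian

/-! ### Signed permutations and shuffles -/

/-- A signed permutation of size `n`: a word of `n` signed letters `(value, sign)` in which each of
the values `0, …, n - 1` appears exactly once. The sign `+` is `true` and the sign `-` is `false`.
The values `1, …, n` of the usual convention are shifted down by one. -/
@[ext]
structure SignedPerm where
  word : List (ℕ × Bool)
  perm : (word.map Prod.fst).Perm (List.range word.length)

namespace SignedPerm

/-- The size of a signed permutation. -/
def size (τ : SignedPerm) : ℕ := τ.word.length

/-- The signed permutation of size `0`. -/
def empty : SignedPerm := ⟨[], List.Perm.nil⟩

theorem word_injective : Function.Injective SignedPerm.word := fun _ _ h => SignedPerm.ext h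

instance : DecidableEq SignedPerm := word_injective.decidableEq

theorem finite_size_eq (n : ℕ) : {τ : SignedPerm | τ.size = n}.Finite := by
  have h1 : {l : List ℕ | l.Perm (List.range n)}.Finite := by
    refine ((List.range n).permutations.toFinset.finite_toSet).subset ?_
    intro l hl
    simpa using hl
  have h2 : {l : List Bool | l.length = n}.Finite := List.finite_length_eq Bool n
  refine Set.Finite.of_finite_image (f := fun τ : SignedPerm =>
    (τ.word.map Prod.fst, τ.word.map Prod.snd)) ((h1.prod h2).subset ?_) ?_
  · rintro _ ⟨τ, hτ, rfl⟩
    have hτ' : τ.word.length = n := hτ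
    refine ⟨?_, ?_⟩
    · simpa [hτ'] using τ.perm
    · simp [hτ']
  · intro τ _ τ' _ h
    apply word_injective
    simp only [Prod.mk.injEq] at h
    have hz : ∀ l : List (ℕ × Bool), (l.map Prod.fst).zip (l.map Prod.snd) = l := by
      intro l
      induction l with
      | nil => rfl
      | cons a l ih => simp [ih]
    rw [← hz τ.word, h.1, h.2, hz]

end SignedPerm

/-- The list of all shuffles of two words. -/
def shuffles {α : Type} : List α → List α → List (List α)
  | [], v => [v]
  | a :: u, [] => [a :: u]
  | a :: u, b :: v =>
      (shuffles u (b :: v)).map (List.cons a) ++ (shuffles (a :: u) v).map (List.cons b)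
termination_by u v => u.length + v.length

/-- Shift all values of a word of signed letters by `n`; signs travel with their values. -/
def shift (n : ℕ) (w : List (ℕ × Bool)) : List (ℕ × Bool) := w.map fun x => (x.1 + n, x.2)

theorem perm_of_mem_shuffles {α : Type} (u v w : List α) (h : w ∈ shuffles u v) :
    w.Perm (u ++ v) := by
  induction u, v using shuffles.induct generalizing w with
  | case1 v => simp [shuffles] at h; simp [h]
  | case2 a u => simp [shuffles] at h; simp [h]
  | case3 a u b v ih1 ih2 =>
    simp only [shuffles, List.mem_append, List.mem_map] at h
    rcases h with ⟨w', hw', rfl⟩ | ⟨w', hw', rfl⟩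
    · exact (ih1 w' hw').cons a
    · exact ((ih2 w' hw').cons b).trans List.perm_middle.symm

/-- A word that is a rearrangement of `τ` followed by the shift of `τ'` is a signed permutation. -/
theorem perm_range_of_perm (τ τ' : SignedPerm) (w : List (ℕ × Bool))
    (h : w.Perm (τ.word ++ shift τ.size τ'.word)) :
    (w.map Prod.fst).Perm (List.range w.length) := by
  have hl : w.length = τ.word.length + τ'.word.length := by simpa [shift] using h.length_eq
  rw [hl, List.range_add]
  refine (h.map _).trans ?_
  rw [List.map_append]
  refine τ.perm.append ?_
  have := τ'.perm.map (fun x => τ.word.length + x)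
  refine List.Perm.trans (List.Perm.of_eq ?_) this
  simp [shift, SignedPerm.size, Function.comp_def, add_comm]

/-- The signed shifted shuffle product of two signed permutations, as a finite set. -/
def shiftedShuffle (τ τ' : SignedPerm) : Finset SignedPerm :=
  ((shuffles τ.word (shift τ.size τ'.word)).attach.map fun w =>
    (⟨w.1, perm_range_of_perm τ τ' w.1 (perm_of_mem_shuffles _ _ _ w.2)⟩ : SignedPerm)).toFinset

theorem mem_shiftedShuffle_iff_word (τ τ' σ : SignedPerm) :
    σ ∈ shiftedShuffle τ τ' ↔ σ.word ∈ shuffles τ.word (shift τ.size τ'.word) := by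
  simp only [shiftedShuffle, List.mem_toFinset, List.mem_map, List.mem_attach, true_and,
    Subtype.exists]
  constructor
  · rintro ⟨w, hw, rfl⟩
    exact hw
  · intro h
    exact ⟨σ.word, h, rfl⟩

/-- Over disjoint alphabets, a word is a shuffle of `u` and `v` exactly if it restricts to `u` on
the first alphabet and to `v` on the second one. -/
theorem mem_shuffles_iff_filter {α : Type} (p : α → Bool) (u v w : List α)
    (hu : ∀ x ∈ u, p x = true) (hv : ∀ x ∈ v, p x = false) :
    w ∈ shuffles u v ↔ w.filter p = u ∧ w.filter (fun x => !p x) = v := by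
  induction u, v using shuffles.induct generalizing w with
  | case1 v =>
    simp only [shuffles, List.mem_singleton]
    constructor
    · rintro rfl
      refine ⟨?_, ?_⟩
      · simpa [List.filter_eq_nil_iff] using hv
      · simpa [List.filter_eq_self] using hv
    · rintro ⟨h1, h2⟩
      rw [← h2, eq_comm, List.filter_eq_self]
      simpa [List.filter_eq_nil_iff] using h1
  | case2 a u =>
    simp only [shuffles, List.mem_singleton]
    constructor
    · rintro rfl
      refine ⟨List.filter_eq_self.2 hu, ?_⟩
      rw [List.filter_eq_nil_iff]
      intro x hx
      simp [hu x hx]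
    · rintro ⟨h1, h2⟩
      rw [← h1, eq_comm, List.filter_eq_self]
      simpa [List.filter_eq_nil_iff] using h2
  | case3 a u b v ih1 ih2 =>
    have ha : p a = true := hu a (by simp)
    have hb : p b = false := hv b (by simp)
    have hu' : ∀ x ∈ u, p x = true := fun x hx => hu x (by simp [hx])
    have hv' : ∀ x ∈ v, p x = false := fun x hx => hv x (by simp [hx])
    simp only [shuffles, List.mem_append, List.mem_map]
    constructor
    · rintro (⟨w', hw', rfl⟩ | ⟨w', hw', rfl⟩)
      · have := (ih1 w' hu' hv).1 hw'
        simp [ha, this.1, this.2]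
      · have := (ih2 w' hu hv').1 hw'
        simp [hb, this.1, this.2]
    · rintro ⟨h1, h2⟩
      cases w with
      | nil => simp at h1
      | cons c w =>
        cases hc : p c with
        | true =>
          simp only [List.filter_cons, hc, if_true, List.cons.injEq, Bool.not_true,
            Bool.false_eq_true, if_false] at h1 h2
          exact Or.inl ⟨w, (ih1 w hu' hv).2 ⟨h1.2, h2⟩, by rw [h1.1]⟩
        | false =>
          simp only [List.filter_cons, hc, if_true, List.cons.injEq, Bool.not_false,
            Bool.false_eq_true, if_false] at h1 h2
          exact Or.inr ⟨w, (ih2 w hu hv').2 ⟨h1, h2.2⟩, by rw [h2.1]⟩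

theorem SignedPerm.fst_lt (τ : SignedPerm) (x : ℕ × Bool) (hx : x ∈ τ.word) : x.1 < τ.size := by
  have := τ.perm.mem_iff.1 (List.mem_map_of_mem (f := Prod.fst) hx)
  simpa [SignedPerm.size] using this

/-- Erasing the large (resp. small) values of a shifted shuffle gives back the first (resp. shifted
second) factor. -/
theorem mem_shiftedShuffle (τ τ' σ : SignedPerm) :
    σ ∈ shiftedShuffle τ τ' ↔ σ.word.filter (fun x => decide (x.1 < τ.size)) = τ.word ∧
      σ.word.filter (fun x => !decide (x.1 < τ.size)) = shift τ.size τ'.word := by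
  rw [mem_shiftedShuffle_iff_word, mem_shuffles_iff_filter]
  · intro x hx
    simpa using τ.fst_lt x hx
  · intro x hx
    simp only [shift, List.mem_map] at hx
    obtain ⟨y, _, rfl⟩ := hx
    simp

theorem size_of_mem_shiftedShuffle {τ τ' σ : SignedPerm} (h : σ ∈ shiftedShuffle τ τ') :
    σ.size = τ.size + τ'.size := by
  have := (perm_of_mem_shuffles _ _ _ ((mem_shiftedShuffle_iff_word _ _ _).1 h)).length_eq
  simpa [shift, SignedPerm.size] using this

theorem shift_injective (n : ℕ) : Function.Injective (shift n) := by
  apply List.map_injective_iff.2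
  rintro ⟨a, b⟩ ⟨c, d⟩ h
  simpa using h

theorem shiftedShuffle_empty_left (τ : SignedPerm) : shiftedShuffle .empty τ = {τ} := by
  ext σ
  rw [mem_shiftedShuffle]
  simp [SignedPerm.empty, SignedPerm.size, shift, SignedPerm.ext_iff]

theorem shiftedShuffle_empty_right (τ : SignedPerm) : shiftedShuffle τ .empty = {τ} := by
  ext σ
  rw [mem_shiftedShuffle_iff_word]
  have : shuffles τ.word [] = [τ.word] := by cases τ.word <;> simp [shuffles]
  simp [SignedPerm.empty, shift, SignedPerm.ext_iff, this]

theorem shiftedShuffle_assoc (τ τ' τ'' : SignedPerm) :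
    ((shiftedShuffle τ τ').biUnion fun ρ => shiftedShuffle ρ τ'') =
      (shiftedShuffle τ' τ'').biUnion fun ρ => shiftedShuffle τ ρ := by
  have shift_filter : ∀ (n m : ℕ) (w : List (ℕ × Bool)),
      (shift n w).filter (fun x => decide (x.1 < n + m)) =
        shift n (w.filter fun x => decide (x.1 < m)) := by
    intro n m w
    simp only [shift, List.filter_map]
    congr 1
    apply List.filter_congr
    intro x _
    simp [add_comm n m]
  have shift_filter' : ∀ (n m : ℕ) (w : List (ℕ × Bool)),
      (shift n w).filter (fun x => !decide (x.1 < n + m)) =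
        shift n (w.filter fun x => !decide (x.1 < m)) := by
    intro n m w
    simp only [shift, List.filter_map]
    congr 1
    apply List.filter_congr
    intro x _
    simp [add_comm n m]
  have shift_shift : ∀ (n m : ℕ) (w : List (ℕ × Bool)),
      shift n (shift m w) = shift (n + m) w := by
    intro n m w
    simp [shift, Function.comp_def, add_assoc, add_comm n m]
  ext σ
  simp only [Finset.mem_biUnion]
  constructor
  · rintro ⟨ρ, hρ, hσ⟩
    have hsize := size_of_mem_shiftedShuffle hρ
    rw [mem_shiftedShuffle] at hρ hσ
    rw [hsize] at hσ
    have key : (σ.word.filter (fun x => !decide (x.1 < τ.size))).Perm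
        (shift τ.size (τ'.word ++ shift τ'.size τ''.word)) := by
      have h1 := List.filter_append_perm (fun x : ℕ × Bool => decide (x.1 < τ.size + τ'.size))
        (σ.word.filter (fun x => !decide (x.1 < τ.size)))
      refine h1.symm.trans (List.Perm.of_eq ?_)
      rw [shift, List.map_append]
      change _ = shift τ.size τ'.word ++ shift τ.size (shift τ'.size τ''.word)
      rw [shift_shift]
      congr 1
      · rw [List.filter_comm, hσ.1, hρ.2]
      · rw [List.filter_comm, ← hσ.2]
        rw [hσ.2, List.filter_eq_self]
        intro x hx
        simp only [shift, List.mem_map] at hx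
        obtain ⟨y, _, rfl⟩ := hx
        simp; omega
    set w : List (ℕ × Bool) :=
      (σ.word.filter (fun x => !decide (x.1 < τ.size))).map (fun x => (x.1 - τ.size, x.2)) with hw
    have hsw : shift τ.size w = σ.word.filter (fun x => !decide (x.1 < τ.size)) := by
      simp only [hw, shift, List.map_map]
      conv_rhs => rw [← List.map_id (σ.word.filter (fun x => !decide (x.1 < τ.size)))]
      apply List.map_congr_left
      intro x hx
      have : τ.size ≤ x.1 := by simpa using (List.mem_filter.1 hx).2
      ext <;> simp [this]
    have hwp : w.Perm (τ'.word ++ shift τ'.size τ''.word) := by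
      rw [← hsw] at key
      refine (List.map_perm_map_iff (f := fun x : ℕ × Bool => (x.1 + τ.size, x.2)) ?_).1 key
      rintro ⟨a, b⟩ ⟨c, d⟩ h
      simpa using h
    refine ⟨⟨w, perm_range_of_perm _ _ _ hwp⟩, ?_, ?_⟩
    · rw [mem_shiftedShuffle]
      constructor
      · apply shift_injective τ.size
        rw [← shift_filter, hsw, List.filter_comm, hσ.1, hρ.2]
      · apply shift_injective τ.size
        rw [← shift_filter', hsw, List.filter_comm, hσ.2, shift_shift, List.filter_eq_self]
        intro x hx
        simp only [shift, List.mem_map] at hx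
        obtain ⟨y, _, rfl⟩ := hx
        simp; omega
    · rw [mem_shiftedShuffle]
      refine ⟨?_, hsw.symm⟩
      rw [← hρ.1, ← hσ.1, List.filter_filter]
      apply List.filter_congr
      intro x _
      by_cases h : x.1 < τ.size <;> simp [h]; omega
  · rintro ⟨ρ, hρ, hσ⟩
    rw [mem_shiftedShuffle] at hρ hσ
    have h1 : (σ.word.filter (fun x => decide (x.1 < τ.size + τ'.size))).filter
        (fun x => decide (x.1 < τ.size)) = τ.word := by
      rw [← hσ.1, List.filter_filter]
      apply List.filter_congr
      intro x _
      by_cases h : x.1 < τ.size <;> simp [h]; omega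
    have h2 : (σ.word.filter (fun x => decide (x.1 < τ.size + τ'.size))).filter
        (fun x => !decide (x.1 < τ.size)) = shift τ.size τ'.word := by
      rw [List.filter_comm, hσ.2, shift_filter, hρ.1]
    have h3 : σ.word.filter (fun x => !decide (x.1 < τ.size + τ'.size)) =
        shift (τ.size + τ'.size) τ''.word := by
      rw [← shift_shift, ← hρ.2, ← shift_filter', ← hσ.2, List.filter_filter]
      apply List.filter_congr
      intro x _
      by_cases h : x.1 < τ.size <;> simp [h]; omega
    have hp : (σ.word.filter (fun x => decide (x.1 < τ.size + τ'.size))).Perm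
        (τ.word ++ shift τ.size τ'.word) := by
      rw [← h1, ← h2, h1]
      conv_rhs => rw [← h1]
      exact (List.filter_append_perm _ _).symm
    have hmem : (⟨_, perm_range_of_perm _ _ _ hp⟩ : SignedPerm) ∈ shiftedShuffle τ τ' := by
      rw [mem_shiftedShuffle]
      exact ⟨h1, h2⟩
    refine ⟨_, hmem, ?_⟩
    rw [mem_shiftedShuffle, size_of_mem_shiftedShuffle hmem]
    exact ⟨rfl, h3⟩

/-! ### The algebra of signed permutations -/

/-- The underlying vector space of the algebra `FQSym±`, with basis indexed by signed
permutations. -/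
def FQSym (K : Type*) [Field K] : Type _ := SignedPerm →₀ K

namespace FQSym

variable (K : Type*) [Field K]

noncomputable instance : AddCommGroup (FQSym K) := inferInstanceAs (AddCommGroup (SignedPerm →₀ K))

noncomputable instance : Module K (FQSym K) := inferInstanceAs (Module K (SignedPerm →₀ K))

/-- The basis `F`. -/
noncomputable def basis : Module.Basis SignedPerm K (FQSym K) := Finsupp.basisSingleOne

/-- The basis element `F τ`. -/
noncomputable def F (τ : SignedPerm) : FQSym K := basis K τ

/-- The product of `FQSym±`: the bilinear map that sends `(F τ, F τ')` to the sum of the `F σ`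
over all `σ` in the shifted shuffle of `τ` and `τ'`. -/
noncomputable def mulMap : FQSym K →ₗ[K] FQSym K →ₗ[K] FQSym K :=
  (basis K).constr K fun τ => (basis K).constr K fun τ' => ∑ σ ∈ shiftedShuffle τ τ', F K σ

theorem mulMap_F (τ τ' : SignedPerm) :
    mulMap K (F K τ) (F K τ') = ∑ σ ∈ shiftedShuffle τ τ', F K σ := by
  simp [mulMap, F]

theorem mulMap_assoc (a b c : FQSym K) :
    mulMap K (mulMap K a b) c = mulMap K a (mulMap K b c) := by
  have : (LinearMap.compr₂ (mulMap K) (mulMap K)) =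
      ((LinearMap.llcomp K (FQSym K) (FQSym K) (FQSym K)).flip ∘ₗ (mulMap K)).flip ∘ₗ
        (mulMap K) := by
    refine (basis K).ext fun τ => (basis K).ext fun τ' => (basis K).ext fun τ'' => ?_
    change mulMap K (mulMap K (F K τ) (F K τ')) (F K τ'') =
      mulMap K (F K τ) (mulMap K (F K τ') (F K τ''))
    rw [mulMap_F, mulMap_F]
    simp only [map_sum, LinearMap.sum_apply, mulMap_F]
    rw [← Finset.sum_biUnion, ← Finset.sum_biUnion, shiftedShuffle_assoc]
    · intro ρ hρ ρ' hρ' hne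
      rw [Function.onFun, Finset.disjoint_left]
      intro σ h h'
      apply hne
      rw [mem_shiftedShuffle] at h h'
      apply SignedPerm.word_injective
      apply shift_injective τ.size
      rw [← h.2, ← h'.2]
    · intro ρ hρ ρ' hρ' hne
      rw [Function.onFun, Finset.disjoint_left]
      intro σ h h'
      apply hne
      rw [mem_shiftedShuffle, size_of_mem_shiftedShuffle hρ] at h
      rw [mem_shiftedShuffle, size_of_mem_shiftedShuffle hρ'] at h'
      apply SignedPerm.word_injective
      rw [← h.1, ← h'.1]
  exact LinearMap.congr_fun (LinearMap.congr_fun (LinearMap.congr_fun this a) b) c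

theorem mulMap_empty_left (a : FQSym K) : mulMap K (F K .empty) a = a := by
  have : mulMap K (F K .empty) = LinearMap.id := by
    refine (basis K).ext fun τ => ?_
    change mulMap K (F K .empty) (F K τ) = F K τ
    rw [mulMap_F, shiftedShuffle_empty_left, Finset.sum_singleton]
  rw [this, LinearMap.id_apply]

theorem mulMap_empty_right (a : FQSym K) : mulMap K a (F K .empty) = a := by
  have : (mulMap K).flip (F K .empty) = LinearMap.id := by
    refine (basis K).ext fun τ => ?_
    change mulMap K (F K τ) (F K .empty) = F K τ
    rw [mulMap_F, shiftedShuffle_empty_right, Finset.sum_singleton]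
  exact LinearMap.congr_fun this a

/-- `FQSym±` is an associative ring with unit `F ∅`. -/
noncomputable instance : Ring (FQSym K) where
  mul a b := mulMap K a b
  one := F K .empty
  mul_assoc := mulMap_assoc K
  one_mul := mulMap_empty_left K
  mul_one := mulMap_empty_right K
  left_distrib a b c := map_add (mulMap K a) b c
  right_distrib a b c := LinearMap.map_add₂ (mulMap K) a b c
  zero_mul a := LinearMap.map_zero₂ (mulMap K) a
  mul_zero a := map_zero (mulMap K a)
  neg_add_cancel := neg_add_cancel
  sub_eq_add_neg := sub_eq_add_neg
  zsmul := fun n a => n • a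
  zsmul_zero' := SubNegMonoid.zsmul_zero'
  zsmul_succ' := SubNegMonoid.zsmul_succ'
  zsmul_neg' := SubNegMonoid.zsmul_neg'
  nsmul := fun n a => n • a
  nsmul_zero := AddMonoid.nsmul_zero
  nsmul_succ := AddMonoid.nsmul_succ

noncomputable instance : Algebra K (FQSym K) :=
  Algebra.ofModule (fun r a b => LinearMap.map_smul₂ (mulMap K) r a b)
    (fun r a b => map_smul (mulMap K a) r b)

theorem F_mul_F (τ τ' : SignedPerm) : F K τ * F K τ' = ∑ σ ∈ shiftedShuffle τ τ', F K σ :=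
  mulMap_F K τ τ'

/-- The homogeneous component of degree `n`, spanned by the signed permutations of size `n`. -/
noncomputable def homogeneous (n : ℕ) : Submodule K (FQSym K) :=
  Submodule.span K (F K '' {τ | τ.size = n})

end FQSym

/-! ### Cambrian trees -/

/-- The vertex set of the subtree of the directed tree with arc relation `arc` that is attached to
`v` at its neighbour `u`: all vertices that can be reached from `u` along edges, in either
direction, without passing through `v`. -/
def branch {n : ℕ} (arc : Fin n → Fin n → Prop) (v u : Fin n) : Set (Fin n) :=
  {w | Relation.ReflTransGen (fun x y => (arc x y ∨ arc y x) ∧ y ≠ v) u w}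

/-- A Cambrian tree on `n` vertices. A vertex is identified with its label in `Fin n`, and
`arc u v` says that there is an arc from `u` to `v`, that is, that `u` is a child of `v` and that
`v` is a parent of `u`. A negative vertex (sign `false`) has one parent slot and two child slots, a
left one and a right one; a positive vertex (sign `true`) has one child slot and two parent slots, a
left one and a right one. Each slot may be occupied by a leaf, which is not a vertex, so that a slot
carries at most one subtree. A subtree in a left (resp. right) slot of `v` has only labels smaller
(resp. larger) than `v`. -/
@[ext]
structure CambrianTree (n : ℕ) where
  sign : Fin n → Bool
  arc : Fin n → Fin n → Prop
  arc_asymm : ∀ u v, arc u v → ¬ arc v u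
  preconnected : (SimpleGraph.fromRel arc).Preconnected
  acyclic : (SimpleGraph.fromRel arc).IsAcyclic
  /-- a negative vertex has at most one parent -/
  neg_parent : ∀ v, sign v = false → ∀ u u', arc v u → arc v u' → u = u'
  /-- a negative vertex has at most one left child and at most one right child -/
  neg_child : ∀ v, sign v = false → ∀ u u', arc u v → arc u' v → (u < v ↔ u' < v) → u = u'
  /-- the descendant subtrees of a negative vertex lie on either side of it -/
  neg_subtree : ∀ v, sign v = false → ∀ u, arc u v →
    (∀ w ∈ branch arc v u, w < v) ∨ (∀ w ∈ branch arc v u, v < w)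
  /-- a positive vertex has at most one child -/
  pos_child : ∀ v, sign v = true → ∀ u u', arc u v → arc u' v → u = u'
  /-- a positive vertex has at most one left parent and at most one right parent -/
  pos_parent : ∀ v, sign v = true → ∀ u u', arc v u → arc v u' → (u < v ↔ u' < v) → u = u'
  /-- the ancestor subtrees of a positive vertex lie on either side of it -/
  pos_subtree : ∀ v, sign v = true → ∀ u, arc v u →
    (∀ w ∈ branch arc v u, w < v) ∨ (∀ w ∈ branch arc v u, v < w)

namespace CambrianTree

/-- The linear extensions of a Cambrian tree `T` on `n` vertices: the signed permutations of size
`n` in which each value carries the sign of `T`, and in which `i` appears before `j` for each arc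
`i → j` of `T`. -/
def linearExtensions {n : ℕ} (T : CambrianTree n) : Set SignedPerm :=
  {τ | τ.size = n ∧ (∀ v : Fin n, ((v : ℕ), T.sign v) ∈ τ.word) ∧
    ∀ i j : Fin n, T.arc i j →
      (τ.word.map Prod.fst).idxOf (i : ℕ) < (τ.word.map Prod.fst).idxOf (j : ℕ)}

theorem finite_linearExtensions {n : ℕ} (T : CambrianTree n) : T.linearExtensions.Finite :=
  (SignedPerm.finite_size_eq n).subset fun _ h => h.1

/-- The element `P T` of `FQSym±`: the sum of `F τ` over all linear extensions `τ` of `T`. -/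
noncomputable def P (K : Type*) [Field K] {n : ℕ} (T : CambrianTree n) : FQSym K :=
  ∑ τ ∈ T.finite_linearExtensions.toFinset, FQSym.F K τ

end CambrianTree

/-- The vector subspace `Camb` of `FQSym±` generated by the elements `P T`, for all Cambrian trees
`T` (on any number of vertices, including the empty tree). -/
noncomputable def Camb (K : Type*) [Field K] : Submodule K (FQSym K) :=
  Submodule.span K {f | ∃ (n : ℕ) (T : CambrianTree n), f = T.P K}

end Cambrian

/-! The tree basis comes from a congruence on words. Rewrite adjacent letters `c a` as `a c` when
some `b` with `a < b < c` is negative and to their right, or positive and to their left (`Reduces`).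
Each step removes one inversion, so every signed permutation rewrites to a minimal one. Uniqueness
of that minimal word is not proved by confluence but through the trees. Every signed permutation is
a linear extension of some tree, built by inserting the labels in increasing order
(`exists_mem_linearExtensions`). Rewriting never leaves the set of linear extensions of a tree
(`exchange_mem_linearExtensions`). Finally, a tree has at most one minimal linear extension
(`eq_of_isMinimal`), since its inversions are all forced by the tree.

Hence `Camb` consists of the elements whose coefficients are constant on congruence classes. The
coefficient of `F σ` in a product is a sum over cuts `k`, pairing the restriction of `σ` to the
values below `k` with its restriction to the others (`coord_mul`). These restrictions respect
rewriting, so `Camb` is closed under products.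

Freeness is a leading-term argument for the number of inversions. In a shifted shuffle the
concatenation has strictly fewest inversions. The class sum of a minimal `m` is `F m` plus terms
with more inversions. A concatenation is minimal exactly when its factors are, and factorization
into indecomposables is unique. So the monomials in the class sums of indecomposable minimal
permutations have distinct leading terms, and these terms run through all minimal permutations. The
monomials are therefore independent, and by triangularity they span.

For the count, minimal permutations are grown by inserting a largest letter. With `k` admissible
positions and either sign, the numbers of positions in the offspring are `2, …, k + 1`: the Catalan
generating tree, doubled. This gives `2 ^ n * catalan n` minimal permutations of size `n`, and the
Catalan recurrence then isolates the indecomposable ones. -/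

namespace Cambrian

/-! ### Insertion of a largest vertex into a Cambrian tree -/

/-- Vertex `e` is visible from the far right at its own height `p e`, among the vertices below `n`:
no larger vertex `b < n` has its wall (upwards if positive, downwards if negative) at that height. -/
def Visible (p : ℕ → ℤ) (s : ℕ → Bool) (n e : ℕ) : Prop :=
  e < n ∧ ∀ b, e < b → b < n → (s b = false → p b < p e) ∧ (s b = true → p e < p b)

/-- The arc relation `arc` on the vertices below `n` is a Cambrian tree with heights `p` and signs
`s`. Every arc `u → v` is the only arc across some cut, and the visible vertices form a chain. -/
structure IsCambrian (p : ℕ → ℤ) (s : ℕ → Bool) (n : ℕ) (arc : ℕ → ℕ → Prop) : Prop where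
  lt : ∀ x y, arc x y → x < n ∧ y < n ∧ p x < p y
  conn : ∀ x y, x < n → y < n → Relation.ReflTransGen (fun x y => arc x y ∨ arc y x) x y
  -- `S` is the side of `u` after deleting the arc. New vertices are attached only to visible ones
  -- and are larger than all others, so a side consisting of hidden vertices stays to the left, and
  -- a side to the right stays to the right. The last clause says that an arc between visible
  -- vertices joins neighbours in the visible chain.
  cut : ∀ u v, arc u v → ∃ S : ℕ → Prop, S u ∧ ¬ S v ∧
    (∀ x y, arc x y → (x ≠ u ∨ y ≠ v) → (S x ↔ S y)) ∧
    (s v = false → (∀ w, w < n → S w → w < v ∧ ¬ Visible p s n w) ∨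
      (∀ w, w < n → S w → v < w)) ∧
    (s u = true → (∀ w, w < n → ¬ S w → w < u ∧ ¬ Visible p s n w) ∨
      (∀ w, w < n → ¬ S w → u < w)) ∧
    (Visible p s n u → Visible p s n v → ∀ w, Visible p s n w →
      (S w → p w ≤ p u) ∧ (¬ S w → p v ≤ p w))
  neg_parent : ∀ v u u', s v = false → arc v u → arc v u' → u = u'
  neg_child : ∀ v u u', s v = false → arc u v → arc u' v → (u < v ↔ u' < v) → u = u'
  pos_child : ∀ v u u', s v = true → arc u v → arc u' v → u = u'
  pos_parent : ∀ v u u', s v = true → arc v u → arc v u' → (u < v ↔ u' < v) → u = u'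
  chain : ∀ x y, Visible p s n x → Visible p s n y → p x < p y →
    (∀ z, Visible p s n z → p x < p z → p z < p y → False) → arc x y
  -- These four clauses say that a slot which insertion may fill is either empty or occupied by the
  -- next visible vertex, whose arc is then replaced.
  neg_vis_parent : ∀ v u, Visible p s n v → s v = false → arc v u → Visible p s n u
  neg_vis_child : ∀ v u, Visible p s n v → s v = false → arc u v → u < v ∨ Visible p s n u
  pos_vis_child : ∀ v u, Visible p s n v → s v = true → arc u v → Visible p s n u
  pos_vis_parent : ∀ v u, Visible p s n v → s v = true → arc v u → u < v ∨ Visible p s n u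

theorem visible_dual (p : ℕ → ℤ) (s : ℕ → Bool) (n e : ℕ) :
    Visible (fun x => - p x) (fun x => !s x) n e ↔ Visible p s n e := by
  simp only [Visible, Bool.not_eq_false', Bool.not_eq_true', neg_lt_neg_iff]
  grind

/-- Turning the picture upside down exchanges the two signs, so insertion has to be checked only for
a negative vertex. -/
theorem IsCambrian.dual {p : ℕ → ℤ} {s : ℕ → Bool} {n : ℕ} {arc : ℕ → ℕ → Prop}
    (h : IsCambrian p s n arc) :
    IsCambrian (fun x => - p x) (fun x => !s x) n (fun x y => arc y x) where
  lt x y hxy := by have := h.lt y x hxy; simp; tauto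
  conn x y hx hy := by
    simpa only [or_comm] using h.conn x y hx hy
  cut u v huv := by
    obtain ⟨S, h1, h2, h3, h4, h5, h6⟩ := h.cut v u huv
    refine ⟨fun x => ¬ S x, h2, not_not.2 h1, fun x y hxy hne => ?_, ?_, ?_, ?_⟩
    · exact not_congr (h3 y x hxy hne.symm).symm
    · simpa [visible_dual] using h5
    · simpa [visible_dual] using h4
    · simp only [visible_dual, neg_le_neg_iff, not_not]
      intro hu hv w hw
      exact (h6 hv hu w hw).symm
  neg_parent v u u' hv := h.pos_child v u u' (by simpa using hv)
  neg_child v u u' hv := h.pos_parent v u u' (by simpa using hv)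
  pos_child v u u' hv := h.neg_parent v u u' (by simpa using hv)
  pos_parent v u u' hv := h.neg_child v u u' (by simpa using hv)
  chain x y := by
    simp only [visible_dual, neg_lt_neg_iff]
    intro hx hy hxy hz
    exact h.chain y x hy hx hxy fun z h1 h2 h3 => hz z h1 h3 h2
  neg_vis_parent v u := by
    simp only [visible_dual, Bool.not_eq_false']; exact h.pos_vis_child v u
  neg_vis_child v u := by
    simp only [visible_dual, Bool.not_eq_false']; exact h.pos_vis_parent v u
  pos_vis_child v u := by
    simp only [visible_dual, Bool.not_eq_true']; exact h.neg_vis_parent v u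
  pos_vis_parent v u := by
    simp only [visible_dual, Bool.not_eq_true']; exact h.neg_vis_child v u

section Insert

variable {p : ℕ → ℤ} {s : ℕ → Bool} {n : ℕ} {arc : ℕ → ℕ → Prop}

/-- The wall below a new negative vertex hides exactly the vertices under it, while nothing lies to
the right of the new vertex itself. -/
theorem visible_succ (hn : s n = false) (e : ℕ) :
    Visible p s (n + 1) e ↔ e = n ∨ (Visible p s n e ∧ p n < p e) := by
  simp only [Visible]
  constructor
  · rintro ⟨h1, h2⟩
    by_cases he : e = n
    · exact Or.inl he
    · refine Or.inr ⟨⟨by omega, fun b hb hb' => h2 b hb (by omega)⟩, ?_⟩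
      exact (h2 n (by omega) (by omega)).1 hn
  · rintro (rfl | ⟨⟨h1, h2⟩, h3⟩)
    · exact ⟨by omega, fun b hb hb' => by omega⟩
    · refine ⟨by omega, fun b hb hb' => ?_⟩
      by_cases he : b = n
      · subst he; simp [hn, h3]
      · exact h2 b hb (by omega)

/-- The last visible vertex below height `p n`. -/
def LastBelow (p : ℕ → ℤ) (s : ℕ → Bool) (n x : ℕ) : Prop :=
  Visible p s n x ∧ p x < p n ∧ ∀ z, Visible p s n z → p z < p n → p z ≤ p x

/-- The first visible vertex above height `p n`. -/
def FirstAbove (p : ℕ → ℤ) (s : ℕ → Bool) (n y : ℕ) : Prop :=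
  Visible p s n y ∧ p n < p y ∧ ∀ z, Visible p s n z → p n < p z → p y ≤ p z

theorem exists_lastBelow {z : ℕ} (hz : Visible p s n z) (hzn : p z < p n) :
    ∃ x, LastBelow p s n x := by
  classical
  obtain ⟨x, hx, hmax⟩ := ((Finset.range n).filter
    (fun x => Visible p s n x ∧ p x < p n)).exists_max_image p ⟨z, by simp [hz, hzn, hz.1]⟩
  simp only [Finset.mem_filter, Finset.mem_range] at hx hmax
  exact ⟨x, hx.2.1, hx.2.2, fun z hz hzn => hmax z ⟨hz.1, hz, hzn⟩⟩

theorem exists_firstAbove {z : ℕ} (hz : Visible p s n z) (hzn : p n < p z) :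
    ∃ x, FirstAbove p s n x := by
  classical
  obtain ⟨x, hx, hmax⟩ := ((Finset.range n).filter
    (fun x => Visible p s n x ∧ p n < p x)).exists_min_image p ⟨z, by simp [hz, hzn, hz.1]⟩
  simp only [Finset.mem_filter, Finset.mem_range] at hx hmax
  exact ⟨x, hx.2.1, hx.2.2, fun z hz hzn => hmax z ⟨hz.1, hz, hzn⟩⟩

/-- Insert the vertex `n` into the chain of visible vertices. -/
def insertArc (p : ℕ → ℤ) (s : ℕ → Bool) (n : ℕ) (arc : ℕ → ℕ → Prop) (x y : ℕ) : Prop :=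
  (arc x y ∧ ¬ (LastBelow p s n x ∧ FirstAbove p s n y)) ∨
    (y = n ∧ LastBelow p s n x) ∨ (x = n ∧ FirstAbove p s n y)

-- The new vertex subdivides the arc of the visible chain that passes its height, or extends the
-- chain at one end. Acyclicity, slot sizes and sides of subtrees survive because only visible
-- vertices are touched.
set_option maxHeartbeats 2000000 in
theorem IsCambrian.insert (h : IsCambrian p s n arc) (hp : Set.InjOn p (Set.Iic n))
    (hn : s n = false) : IsCambrian p s (n + 1) (insertArc p s n arc) := by
  have hL : ∀ x x', LastBelow p s n x → LastBelow p s n x' → x = x' := fun x x' hx hx' =>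
    hp hx.1.1.le hx'.1.1.le (le_antisymm (hx'.2.2 x hx.1 hx.2.1) (hx.2.2 x' hx'.1 hx'.2.1))
  have hF : ∀ x x', FirstAbove p s n x → FirstAbove p s n x' → x = x' := fun x x' hx hx' =>
    hp hx.1.1.le hx'.1.1.le (le_antisymm (hx.2.2 x' hx'.1 hx'.2.1) (hx'.2.2 x hx.1 hx.2.1))
  have hLF : ∀ x y, LastBelow p s n x → FirstAbove p s n y → arc x y := fun x y hx hy =>
    h.chain x y hx.1 hy.1 (hx.2.1.trans hy.2.1) fun z hz h1 h2 => by
      rcases lt_trichotomy (p z) (p n) with h3 | h3 | h3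
      · have := hx.2.2 z hz h3; omega
      · have := hp hz.1.le (Set.mem_Iic.2 le_rfl) h3; have := hz.1; omega
      · have := hy.2.2 z hz h3; omega
  have hpn : ∀ x, Visible p s n x → p x ≠ p n := fun x hx he => by
    have := hp hx.1.le (Set.mem_Iic.2 le_rfl) he; have := hx.1; omega
  have hlast : ∀ m, n = m + 1 → Visible p s n m := fun m hm => ⟨by omega, fun b _ _ => by omega⟩
  have hL0 : ∀ x, LastBelow p s n x → x < n ∧ p x < p n := fun x hx => ⟨hx.1.1, hx.2.1⟩
  have hF0 : ∀ x, FirstAbove p s n x → x < n ∧ p n < p x := fun x hx => ⟨hx.1.1, hx.2.1⟩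
  have hlt := h.lt
  -- An arc between visible vertices that crosses height `p n` is exactly the one to be removed.
  have hconsec : ∀ x y, arc x y → Visible p s n x → Visible p s n y → p x < p n → p n < p y →
      LastBelow p s n x ∧ FirstAbove p s n y := by
    intro x y hxy hx hy hx' hy'
    obtain ⟨S, h1, h2, h3, h4, h5, h6⟩ := h.cut x y hxy
    refine ⟨⟨hx, hx', fun z hz hzn => ?_⟩, ⟨hy, hy', fun z hz hzn => ?_⟩⟩
    · have := h6 hx hy z hz; by_cases hS : S z
      · exact this.1 hS
      · have := this.2 hS; omega
    · have := h6 hx hy z hz; by_cases hS : S z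
      · have := this.1 hS; omega
      · exact this.2 hS
  have hL1 : ∀ x z, LastBelow p s n x → Visible p s n z → p z < p n → p z ≤ p x :=
    fun x z hx => hx.2.2 z
  have hF1 : ∀ x z, FirstAbove p s n x → Visible p s n z → p n < p z → p x ≤ p z :=
    fun x z hx => hx.2.2 z
  have hLv : ∀ x, LastBelow p s n x → Visible p s n x := fun x hx => hx.1
  have hFv : ∀ x, FirstAbove p s n x → Visible p s n x := fun x hx => hx.1
  -- A larger vertex with the wrong sign would hide the other one. This decides which slot, left or
  -- right, the arcs of the chain occupy.
  have hVs : ∀ x y, Visible p s n x → Visible p s n y → p x < p y →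
      (s y = false → y < x) ∧ (s x = true → x < y) := by
    intro x y hx hy hxy
    have := hx.2 y; have := hy.2 x; have := hx.1; have := hy.1
    constructor
    · intro h; by_contra h'
      have : x ≠ y := by rintro rfl; omega
      grind
    · intro h; by_contra h'
      have : x ≠ y := by rintro rfl; omega
      grind
  have hnvp := h.neg_vis_parent
  have hnvc := h.neg_vis_child
  have hpvp := h.pos_vis_parent
  have hpvc := h.pos_vis_child
  have hnp := h.neg_parent
  have hnc := h.neg_child
  have hpp := h.pos_parent
  have hpc := h.pos_child
  refine ⟨?_, ?_, ?_, ?_, ?_, ?_, ?_, ?_, ?_, ?_, ?_, ?_⟩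
  · rintro x y (⟨h1, -⟩ | ⟨rfl, h1⟩ | ⟨rfl, h1⟩)
    · grind
    · grind
    · grind
  · set R := fun x y => insertArc p s n arc x y ∨ insertArc p s n arc y x with hR
    have hsymm : ∀ x y, Relation.ReflTransGen R x y → Relation.ReflTransGen R y x :=
      fun x y hxy => by
        induction hxy with
        | refl => exact .refl
        | tail _ hbc ih => exact .head hbc.symm ih
    have hstep : ∀ x y, arc x y → Relation.ReflTransGen R x y := by
      intro x y hxy
      by_cases hrem : LastBelow p s n x ∧ FirstAbove p s n y
      · exact .tail (.single (Or.inl (Or.inr (Or.inl ⟨rfl, hrem.1⟩))))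
          (Or.inl (Or.inr (Or.inr ⟨rfl, hrem.2⟩)))
      · exact .single (Or.inl (Or.inl ⟨hxy, hrem⟩))
    have hold : ∀ x y, x < n → y < n → Relation.ReflTransGen R x y := by
      intro x y hx hy
      have := h.conn x y hx hy
      induction this with
      | refl => exact .refl
      | tail h1 h2 ih =>
        rcases h2 with h2 | h2
        · exact (ih (hlt _ _ h2).1).trans (hstep _ _ h2)
        · exact (ih (hlt _ _ h2).2.1).trans (hsymm _ _ (hstep _ _ h2))
    have hnew : ∀ x, x < n → Relation.ReflTransGen R x n := by
      intro x hx
      obtain ⟨m, rfl⟩ : ∃ m, n = m + 1 := ⟨n - 1, by omega⟩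
      have hm := hlast m rfl
      rcases lt_or_gt_of_ne (hpn m hm) with h1 | h1
      · obtain ⟨l, hl⟩ := exists_lastBelow hm h1
        exact (hold x l hx hl.1.1).tail (Or.inl (Or.inr (Or.inl ⟨rfl, hl⟩)))
      · obtain ⟨l, hl⟩ := exists_firstAbove hm h1
        exact (hold x l hx hl.1.1).tail (Or.inr (Or.inr (Or.inr ⟨rfl, hl⟩)))
    intro x y hx hy
    rcases Nat.lt_succ_iff_lt_or_eq.1 hx with hx | rfl
    · rcases Nat.lt_succ_iff_lt_or_eq.1 hy with hy | rfl
      · exact hold x y hx hy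
      · exact hnew x hx
    · rcases Nat.lt_succ_iff_lt_or_eq.1 hy with hy | rfl
      · exact hsymm _ _ (hnew y hy)
      · exact .refl
  · clear hnvc hpvp hpvc hnvp hnp hpp hpc hnc hVs
    rintro u v (⟨huv, hrem⟩ | ⟨hvn, hu⟩ | ⟨hun, hv⟩)
    · obtain ⟨S, h1, h2, h3, h4, h5, h6⟩ := h.cut u v huv
      have hS : ∀ l f, LastBelow p s n l → FirstAbove p s n f → (S l ↔ S f) := fun l f hl hf =>
        h3 l f (hLF l f hl hf) (by grind)
      -- The vertex `n` joins the side of its neighbours. By `hS` two neighbours lie on the same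
      -- side, as the arc between them is not the one being cut.
      refine ⟨fun w => (w < n ∧ S w) ∨ (w = n ∧ ((∃ l, LastBelow p s n l ∧ S l) ∨
        ∃ f, FirstAbove p s n f ∧ S f)), ?_, ?_, ?_, ?_, ?_, ?_⟩
      · grind
      · grind
      · rintro x y (⟨h1, -⟩ | ⟨rfl, h1⟩ | ⟨rfl, h1⟩)
        · grind
        · grind
        · grind
      · intro hv
        rcases h4 hv with h4 | h4
        · left
          simp only [visible_succ hn]
          grind
        · right
          grind
      · intro hu
        rcases h5 hu with h5 | h5
        · left
          simp only [visible_succ hn]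
          -- `n` has at least one neighbour, since `n - 1` is always visible. That neighbour cannot
          -- lie on the hidden side, so neither does `n`.
          have hSn : ∃ l, (LastBelow p s n l ∨ FirstAbove p s n l) := by
            obtain ⟨m, rfl⟩ : ∃ m, n = m + 1 := ⟨n - 1, by grind⟩
            have hm := hlast m rfl
            rcases lt_or_gt_of_ne (hpn m hm) with h1 | h1
            · exact (exists_lastBelow hm h1).imp fun _ h => Or.inl h
            · exact (exists_firstAbove hm h1).imp fun _ h => Or.inr h
          grind
        · right
          grind
      · simp only [visible_succ hn]
        intro hu hv
        obtain ⟨hu, hu'⟩ := hu.resolve_left (by grind)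
        obtain ⟨hv, hv'⟩ := hv.resolve_left (by grind)
        obtain ⟨f, hf⟩ := exists_firstAbove hu hu'
        have h7 := h6 hu hv
        have hSf : S f := by
          by_contra hSf
          have := (h7 f hf.1).2 hSf; have := hf.2.2 u hu hu'; have := (hlt u v huv).2.2; omega
        rintro w (rfl | ⟨hw, hw'⟩)
        · exact ⟨fun _ => hu'.le, fun hw => (hw (Or.inr ⟨rfl, Or.inr ⟨f, hf, hSf⟩⟩)).elim⟩
        · exact ⟨fun hS => (h7 w hw).1 (by grind), fun hS => (h7 w hw).2 fun hS' => hS (Or.inl ⟨hw.1, hS'⟩)⟩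
    · by_cases hf : ∃ f, FirstAbove p s n f
      · obtain ⟨f, hf⟩ := hf
        obtain ⟨S, h1, h2, h3, h4, h5, h6⟩ := h.cut u f (hLF u f hu hf)
        -- The arc `u → n` replaces `u → f` and inherits its cut, with `n` on the side of `f`.
        refine ⟨fun w => w < n ∧ S w, ?_, ?_, ?_, ?_, ?_, ?_⟩
        · grind
        · grind
        · rintro x y (⟨h1, h2⟩ | ⟨rfl, h1⟩ | ⟨rfl, h1⟩) hxy
          · grind
          · grind
          · grind
        · intro _
          left
          simp only [visible_succ hn]
          grind
        · intro hu
          right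
          grind
        · simp only [visible_succ hn]
          grind
      -- Without a visible vertex above, `n` hangs on `u` alone, so the cut separates `n` from
      -- everything else.
      · refine ⟨fun w => w < n, ?_, ?_, ?_, ?_, ?_, ?_⟩
        · grind
        · grind
        · rintro x y (⟨h1, h2⟩ | ⟨rfl, h1⟩ | ⟨rfl, h1⟩) hxy
          · grind
          · grind
          · grind
        · intro _
          left
          simp only [visible_succ hn]
          intro w hw hw'
          refine ⟨by omega, ?_⟩
          rintro (rfl | ⟨h1, h2⟩)
          · omega
          · exact hf (exists_firstAbove h1 h2)
        · intro hu
          right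
          grind
        · simp only [visible_succ hn]
          grind
    · by_cases hf : ∃ f, LastBelow p s n f
      · obtain ⟨f, hf⟩ := hf
        obtain ⟨S, h1, h2, h3, h4, h5, h6⟩ := h.cut f v (hLF f v hf hv)
        refine ⟨fun w => w = n ∨ (w < n ∧ S w), ?_, ?_, ?_, ?_, ?_, ?_⟩
        · grind
        · grind
        · rintro x y (⟨h1, h2⟩ | ⟨rfl, h1⟩ | ⟨rfl, h1⟩) hxy
          · grind
          · grind
          · grind
        · intro _
          right
          grind
        · grind
        · simp only [visible_succ hn]
          grind
      · refine ⟨fun w => w = n, ?_, ?_, ?_, ?_, ?_, ?_⟩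
        · grind
        · grind
        · rintro x y (⟨h1, h2⟩ | ⟨rfl, h1⟩ | ⟨rfl, h1⟩) hxy
          · grind
          · grind
          · grind
        · intro _
          right
          grind
        · grind
        · simp only [visible_succ hn]
          grind
  · clear hnvc hpvp hpvc hnc hpp hpc hVs
    unfold insertArc; grind
  · clear hnvp hpvp hpvc hnp hpp hpc
    unfold insertArc; grind
  · clear hnvp hpvp hnvc hnp hpp hnc
    unfold insertArc; grind
  · clear hnvp hpvc hnvc hnp hpc hnc
    unfold insertArc; grind
  · have hch := h.chain
    clear hnvp hpvp hpvc hnvc hnp hpp hpc hnc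
    simp only [visible_succ hn, insertArc]
    rintro x y (rfl | ⟨hx, hx'⟩) (rfl | ⟨hy, hy'⟩) hxy hz
    · omega
    · exact Or.inr (Or.inr ⟨rfl, hy, hy', fun z hz1 hz2 => not_lt.1
        (hz z (Or.inr ⟨hz1, hz2⟩) hz2)⟩)
    · omega
    · exact Or.inl ⟨hch x y hx hy hxy fun z h1 h2 h3 => hz z (Or.inr ⟨h1, by omega⟩) h2 h3,
        fun hL => by have := hL0 x hL.1; omega⟩
  · clear hnvc hpvp hpvc hnc hpp hpc hVs
    simp only [visible_succ hn, insertArc]; grind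
  · clear hnvp hpvp hpvc hnp hpp hpc
    simp only [visible_succ hn, insertArc]; grind
  · clear hnvp hpvp hnvc hnp hpp hnc
    simp only [visible_succ hn, insertArc]; grind
  · clear hnvp hpvc hnvc hnp hpc hnc
    simp only [visible_succ hn, insertArc]; grind
end Insert
end Cambrian

/-! ### Every signed permutation is a linear extension -/

namespace Cambrian

theorem exists_isCambrian (p : ℕ → ℤ) (s : ℕ → Bool) (n : ℕ) (hp : Set.InjOn p (Set.Iio n)) :
    ∃ arc, IsCambrian p s n arc := by
  induction n with
  | zero =>
    refine ⟨fun _ _ => False, ?_⟩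
    constructor <;> simp [Visible]
  | succ n ih =>
    obtain ⟨arc, h⟩ := ih (hp.mono fun x hx => lt_trans (Set.mem_Iio.1 hx) n.lt_succ_self)
    have hp' : Set.InjOn p (Set.Iic n) := hp.mono fun x hx => Nat.lt_succ_of_le hx
    cases hs : s n with
    | false => exact ⟨_, h.insert hp' hs⟩
    | true =>
      have hq : Set.InjOn (fun x => - p x) (Set.Iic n) := fun x hx y hy hxy =>
        hp' hx hy (neg_injective hxy)
      -- A positive vertex is inserted as a negative one in the dual tree.
      have := (h.dual.insert hq (by simp [hs])).dual
      simp only [neg_neg, Bool.not_not] at this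
      exact ⟨_, this⟩

/-- The Cambrian tree of an arc relation on the vertices below `n`. -/
def IsCambrian.toTree {p : ℕ → ℤ} {s : ℕ → Bool} {n : ℕ} {arc : ℕ → ℕ → Prop}
    (h : IsCambrian p s n arc) : CambrianTree n where
  sign v := s v
  arc u v := arc u v
  arc_asymm u v huv hvu := by
    have := h.lt _ _ huv; have := h.lt _ _ hvu; omega
  preconnected := by
    intro x y
    have key : ∀ b : ℕ, Relation.ReflTransGen (fun x y => arc x y ∨ arc y x) x b →
        ∀ hb : b < n, (SimpleGraph.fromRel fun u v : Fin n => arc u v).Reachable x ⟨b, hb⟩ := by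
      intro b hb
      induction hb with
      | refl => exact fun _ => .rfl
      | @tail b c _ hbc ih =>
        intro hc
        have hb : b < n := by rcases hbc with hbc | hbc <;> have := h.lt _ _ hbc <;> omega
        refine (ih hb).trans (SimpleGraph.Adj.reachable ?_)
        rw [SimpleGraph.fromRel_adj]
        refine ⟨fun he => ?_, hbc⟩
        obtain rfl : b = c := congrArg Fin.val he
        rcases hbc with hbc | hbc <;> have := h.lt _ _ hbc <;> omega
    exact key y (h.conn x y x.2 y.2) y.2
  acyclic := by
    rw [SimpleGraph.isAcyclic_iff_forall_adj_isBridge]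
    -- A walk avoiding the arc cannot leave the side `S` of its cut, so every edge is a bridge.
    have key : ∀ u v : Fin n, arc u v →
        (SimpleGraph.fromRel fun u v : Fin n => arc u v).IsBridge s(u, v) := by
      intro u v huv
      obtain ⟨S, h1, h2, h3, -⟩ := h.cut u v huv
      rw [SimpleGraph.isBridge_iff]
      rintro ⟨w⟩
      apply h2
      have : ∀ (a b : Fin n) (w : ((SimpleGraph.fromRel fun u v : Fin n => arc u v) \
          SimpleGraph.fromEdgeSet {s(u, v)}).Walk a b), S a → S b := by
        intro a b w
        induction w with
        | nil => exact id
        | cons hadj _ ih =>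
          refine fun ha => ih ?_
          simp only [SimpleGraph.sdiff_adj, SimpleGraph.fromRel_adj,
            SimpleGraph.fromEdgeSet_adj, Set.mem_singleton_iff, Sym2.eq_iff] at hadj
          grind
      exact this u v w h1
    intro v w hvw
    rw [SimpleGraph.fromRel_adj] at hvw
    rcases hvw.2 with h1 | h1
    · exact key v w h1
    · rw [Sym2.eq_swap]; exact key w v h1
  neg_parent v hv u u' h1 h2 := Fin.ext (h.neg_parent v u u' hv h1 h2)
  neg_child v hv u u' h1 h2 h3 := Fin.ext (h.neg_child v u u' hv h1 h2 h3)
  pos_child v hv u u' h1 h2 := Fin.ext (h.pos_child v u u' hv h1 h2)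
  pos_parent v hv u u' h1 h2 h3 := Fin.ext (h.pos_parent v u u' hv h1 h2 h3)
  neg_subtree v hv u huv := by
    obtain ⟨S, h1, h2, h3, h4, -⟩ := h.cut u v huv
    -- Walks in the branch never visit `v`, hence never use the arc `u → v`, and stay on the side of
    -- `u`.
    have key : ∀ w ∈ branch (fun u v : Fin n => arc u v) v u, S w := by
      intro w hw
      have hw : Relation.ReflTransGen _ _ _ := hw
      induction hw with
      | refl => exact h1
      | @tail b c hb hbc ih =>
        have := h3 b c; have := h3 c b; have := ih hb
        have : c.1 ≠ v.1 := fun hc => hbc.2 (Fin.ext hc)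
        grind
    rcases h4 hv with h4 | h4
    · exact Or.inl fun w hw => Fin.lt_def.2 (h4 w w.2 (key w hw)).1
    · exact Or.inr fun w hw => Fin.lt_def.2 (h4 w w.2 (key w hw))
  pos_subtree v hv u huv := by
    obtain ⟨S, h1, h2, h3, -, h4, -⟩ := h.cut v u huv
    have key : ∀ w ∈ branch (fun u v : Fin n => arc u v) v u, ¬ S w := by
      intro w hw
      have hw : Relation.ReflTransGen _ _ _ := hw
      induction hw with
      | refl => exact h2
      | @tail b c hb hbc ih =>
        have := h3 b c; have := h3 c b; have := ih hb
        have : c.1 ≠ v.1 := fun hc => hbc.2 (Fin.ext hc)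
        grind
    rcases h4 hv with h4 | h4
    · exact Or.inl fun w hw => Fin.lt_def.2 (h4 w w.2 (key w hw)).1
    · exact Or.inr fun w hw => Fin.lt_def.2 (h4 w w.2 (key w hw))

theorem SignedPerm.mem_values_iff (τ : SignedPerm) (x : ℕ) :
    x ∈ τ.word.map Prod.fst ↔ x < τ.size := by
  rw [τ.perm.mem_iff]; simp [SignedPerm.size]

theorem SignedPerm.nodup_values (τ : SignedPerm) : (τ.word.map Prod.fst).Nodup :=
  τ.perm.nodup_iff.2 List.nodup_range

/-- Every signed permutation is a linear extension of some Cambrian tree. -/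
theorem exists_mem_linearExtensions (τ : SignedPerm) :
    ∃ T : CambrianTree τ.size, τ ∈ T.linearExtensions := by
  obtain ⟨arc, h⟩ := exists_isCambrian (fun x => ((τ.word.map Prod.fst).idxOf x : ℤ))
    (fun x => decide ((x, true) ∈ τ.word)) τ.size (by
      intro x hx y hy hxy
      exact (List.idxOf_inj ((τ.mem_values_iff x).2 hx)).1 (Int.ofNat_inj.1 hxy))
  refine ⟨h.toTree, rfl, fun v => ?_, fun i j hij => by exact_mod_cast (h.lt _ _ hij).2.2⟩
  by_cases hv : (v.1, true) ∈ τ.word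
  · simp [IsCambrian.toTree, hv]
  · obtain ⟨⟨x, b⟩, hx, rfl⟩ := List.mem_map.1 ((τ.mem_values_iff v).2 v.2)
    have hb : b = false := by
      cases b
      · rfl
      · exact (hv hx).elim
    subst hb
    simpa [IsCambrian.toTree, hv] using hx

end Cambrian

/-! ### Paths in a Cambrian tree and their first turning point -/

namespace Cambrian
open Relation

theorem branch_swap {n : ℕ} (arc : Fin n → Fin n → Prop) (v u : Fin n) :
    branch (fun x y => arc y x) v u = branch arc v u := by
  simp only [branch, or_comm]

namespace CambrianTree

variable {n : ℕ}

/-- The Cambrian tree with all arcs and all signs reversed. -/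
def dual (T : CambrianTree n) : CambrianTree n where
  sign v := !T.sign v
  arc u v := T.arc v u
  arc_asymm u v := T.arc_asymm v u
  preconnected := by
    convert T.preconnected using 1
    ext; simp [or_comm]
  acyclic := by
    convert T.acyclic using 1
    ext; simp [or_comm]
  neg_parent v hv := T.pos_child v (by simpa using hv)
  neg_child v hv := T.pos_parent v (by simpa using hv)
  neg_subtree v hv u := by
    rw [branch_swap]; exact T.pos_subtree v (by simpa using hv) u
  pos_child v hv := T.neg_parent v (by simpa using hv)
  pos_parent v hv := T.neg_child v (by simpa using hv)
  pos_subtree v hv u := by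
    rw [branch_swap]; exact T.neg_subtree v (by simpa using hv) u

theorem branch_dual (T : CambrianTree n) (v u : Fin n) :
    branch T.dual.arc v u = branch T.arc v u := branch_swap T.arc v u

theorem transGen_dual (T : CambrianTree n) (x y : Fin n) :
    TransGen T.dual.arc x y ↔ TransGen T.arc y x := transGen_swap

theorem sign_dual (T : CambrianTree n) (v : Fin n) : T.dual.sign v = !T.sign v := rfl

/-- The branches of a vertex `d` at distinct children (resp. parents) lie on different sides. -/
theorem opposite_branches (T : CambrianTree n) {d u u' x : Fin n} (hu : T.arc u d)
    (hu' : T.arc u' d) (hne : u ≠ u') (hx : x ∈ branch T.arc d u) :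
    T.sign d = false ∧ ((x < d ∧ ∀ w ∈ branch T.arc d u', d < w) ∨
      (d < x ∧ ∀ w ∈ branch T.arc d u', w < d)) := by
  have hd : T.sign d = false := by
    by_contra h
    exact hne (T.pos_child d (by simpa using h) u u' hu hu')
  refine ⟨hd, ?_⟩
  have h1 := T.neg_subtree d hd u hu
  have h2 := T.neg_subtree d hd u' hu'
  have h3 := T.neg_child d hd u u' hu hu'
  have hu0 : u ∈ branch T.arc d u := ReflTransGen.refl
  have hu0' : u' ∈ branch T.arc d u' := ReflTransGen.refl
  rcases h1 with h1 | h1 <;> rcases h2 with h2 | h2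
  · exact (hne (h3 (by simp [h1 u hu0, h2 u' hu0']))).elim
  · exact Or.inl ⟨h1 x hx, h2⟩
  · exact Or.inr ⟨h1 x hx, h2⟩
  · exact (hne (h3 (iff_of_false (h1 u hu0).not_gt (h2 u' hu0').not_gt))).elim

theorem mem_branch_of_walk (T : CambrianTree n) {d z y : Fin n}
    (w : (SimpleGraph.fromRel T.arc).Walk z y) (hd : d ∉ w.support) : y ∈ branch T.arc d z := by
  induction w with
  | nil => exact ReflTransGen.refl
  | @cons a b c hab w ih =>
    simp only [SimpleGraph.Walk.support_cons, List.mem_cons, not_or] at hd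
    refine ReflTransGen.head ⟨((SimpleGraph.fromRel_adj _ _ _).1 hab).2, ?_⟩ (ih hd.2)
    rintro rfl
    exact hd.2 w.start_mem_support

/-- Follow a path that starts upwards from `x`. Either it rises all the way, or it first turns down
at a vertex `d` with two distinct children on the path; then `d` is negative and separates the label
of `x` from all labels in the branch containing `y`. The hypotheses record the invariant that `z`
has been reached from its child `z'` on an ascent from `x`. -/
theorem up_or_peak (T : CambrianTree n) {x z' z y : Fin n}
    (w : (SimpleGraph.fromRel T.arc).Walk z y) (hw : w.IsPath) (harc : T.arc z' z)
    (hxz : TransGen T.arc x z) (hx : x ∈ branch T.arc z z')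
    (hx' : ∀ v ∈ w.support, v ≠ z → x ∈ branch T.arc v z) (hz' : z' ∉ w.support) :
    TransGen T.arc x y ∨ ∃ d u', T.sign d = false ∧ TransGen T.arc x d ∧ y ∈ branch T.arc d u' ∧
      ((x < d ∧ ∀ v ∈ branch T.arc d u', d < v) ∨ (d < x ∧ ∀ v ∈ branch T.arc d u', v < d)) := by
  induction w generalizing z' with
  | nil => exact Or.inl hxz
  | @cons a b c hab w ih =>
    have hab' := ((SimpleGraph.fromRel_adj _ _ _).1 hab)
    rw [SimpleGraph.Walk.cons_isPath_iff] at hw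
    simp only [SimpleGraph.Walk.support_cons, List.mem_cons, not_or] at hx' hz'
    rcases hab'.2 with h1 | h1
    · refine ih hw.1 h1 (hxz.tail h1) (hx' b (Or.inr w.start_mem_support) hab'.1.symm) ?_ hw.2
      intro v hv hvb
      have hva : v ≠ a := by rintro rfl; exact hw.2 hv
      exact ReflTransGen.head ⟨Or.inr h1, hva.symm⟩ (hx' v (Or.inr hv) hva)
    · right
      have hne : z' ≠ b := by rintro rfl; exact hz'.2 w.start_mem_support
      have := T.opposite_branches harc h1 hne hx
      exact ⟨a, b, this.1, hxz, T.mem_branch_of_walk w hw.2, this.2⟩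

/-- Two vertices incomparable in the tree are separated by the first turning point of the path
between them. -/
theorem comparable_or_turn (T : CambrianTree n) {x y : Fin n} (hxy : x ≠ y) :
    TransGen T.arc x y ∨ TransGen T.arc y x ∨ ∃ d u',
      ((T.sign d = false ∧ TransGen T.arc x d) ∨ (T.sign d = true ∧ TransGen T.arc d x)) ∧
      y ∈ branch T.arc d u' ∧
      ((x < d ∧ ∀ v ∈ branch T.arc d u', d < v) ∨ (d < x ∧ ∀ v ∈ branch T.arc d u', v < d)) := by
  have key : ∀ (T : CambrianTree n) (z : Fin n) (w : (SimpleGraph.fromRel T.arc).Walk z y),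
      w.IsPath → x ∉ w.support → T.arc x z →
      TransGen T.arc x y ∨ ∃ d u', T.sign d = false ∧ TransGen T.arc x d ∧ y ∈ branch T.arc d u' ∧
      ((x < d ∧ ∀ v ∈ branch T.arc d u', d < v) ∨ (d < x ∧ ∀ v ∈ branch T.arc d u', v < d)) := by
    intro T z w hw hx hxz
    refine T.up_or_peak w hw hxz (.single hxz) .refl (fun v hv hvz => .single ⟨Or.inr hxz, ?_⟩) hx
    rintro rfl
    exact hx hv
  obtain ⟨w, hw⟩ := (T.preconnected x y).exists_isPath
  cases w with
  | nil => exact (hxy rfl).elim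
  | @cons _ z _ hxz w =>
    rw [SimpleGraph.Walk.cons_isPath_iff] at hw
    rcases ((SimpleGraph.fromRel_adj _ _ _).1 hxz).2 with h1 | h1
    · rcases key T z w hw.1 hw.2 h1 with h2 | ⟨d, u', h2, h3, h4⟩
      · exact Or.inl h2
      · exact Or.inr (Or.inr ⟨d, u', Or.inl ⟨h2, h3⟩, h4⟩)
    · have hG : SimpleGraph.fromRel T.arc = SimpleGraph.fromRel T.dual.arc := by
        ext; simp [dual, or_comm]
      have h5 := key T.dual z (w.transfer _ fun e he => by
        rw [← hG]; exact w.edges_subset_edgeSet he) (hw.1.transfer _) (by simpa using hw.2) h1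
      simp only [transGen_dual, branch_dual, sign_dual, Bool.not_eq_false'] at h5
      rcases h5 with h2 | ⟨d, u', h2, h3, h4⟩
      · exact Or.inr (Or.inl h2)
      · exact Or.inr (Or.inr ⟨d, u', Or.inr ⟨h2, h3⟩, h4⟩)

theorem transGen_lt (T : CambrianTree n) {p : Fin n → ℤ} (hp : ∀ i j, T.arc i j → p i < p j)
    {x y : Fin n} (h : TransGen T.arc x y) : p x < p y := by
  induction h with
  | single h => exact hp _ _ h
  | tail _ h ih => exact ih.trans (hp _ _ h)

/-- The heights `p` exclude a return to `y` along the ascent, so everything before its last arc lies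
in a single branch at `y`. -/
theorem exists_child_of_transGen (T : CambrianTree n) {p : Fin n → ℤ}
    (hp : ∀ i j, T.arc i j → p i < p j) {x y : Fin n} (h : TransGen T.arc x y) :
    ∃ u, T.arc u y ∧ x ∈ branch T.arc y u := by
  induction h using TransGen.head_induction_on with
  | single h => exact ⟨_, h, .refl⟩
  | @head a c h1 h2 ih =>
    obtain ⟨u, hu, hc⟩ := ih
    refine ⟨u, hu, ReflTransGen.tail hc ⟨Or.inr h1, ?_⟩⟩
    rintro rfl
    have := hp _ _ h1
    have := T.transGen_lt hp h2
    omega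

/-- No arc passes above a later negative vertex `b` whose label separates its ends. -/
theorem not_arc_of_neg (T : CambrianTree n) {p : Fin n → ℤ} (hp : ∀ i j, T.arc i j → p i < p j)
    {x y b : Fin n} (hxy : T.arc x y) (hb : T.sign b = false) (hyb : p y < p b)
    (hsep : (x < b ∧ b < y) ∨ (y < b ∧ b < x)) : False := by
  have hxb := (hp _ _ hxy).trans hyb
  have hbx : b ≠ x := by rintro rfl; omega
  have hby : b ≠ y := by rintro rfl; omega
  -- A child branch of `b` lies on one side of `b`, whereas `x` and `y` lie on different sides. So
  -- neither of them is a descendant of `b`: the arc between them would put both in one branch.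
  have hchild : ∀ u, T.arc u b → ¬ (x ∈ branch T.arc b u ∧ y ∈ branch T.arc b u) := by
    rintro u hu ⟨h1, h2⟩
    rcases T.neg_subtree b hb u hu with h3 | h3
    · have := h3 x h1; have := h3 y h2; omega
    · have := h3 x h1; have := h3 y h2; omega
  have hnx : ¬ TransGen T.arc x b := fun h => by
    obtain ⟨u, hu, hxu⟩ := T.exists_child_of_transGen hp h
    exact hchild u hu ⟨hxu, ReflTransGen.tail hxu ⟨Or.inl hxy, hby.symm⟩⟩
  have hny : ¬ TransGen T.arc y b := fun h => by
    obtain ⟨u, hu, hyu⟩ := T.exists_child_of_transGen hp h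
    exact hchild u hu ⟨ReflTransGen.tail hyu ⟨Or.inr hxy, hbx.symm⟩, hyu⟩
  rcases T.comparable_or_turn hbx with h | h | ⟨d, u', h1, h2, h3⟩
  · have := T.transGen_lt hp h; omega
  · exact hnx h
  -- At a turn between `b` and `x` the arc keeps `y` in the branch of `x`, so `x` and `y` lie beyond
  -- `d` on the same side of `b`.
  · have hyd : y ≠ d := by
      rintro rfl
      rcases h1 with ⟨-, h1⟩ | ⟨-, h1⟩
      · have := T.transGen_lt hp h1; omega
      · exact hny h1
    have h4 : y ∈ branch T.arc d u' := ReflTransGen.tail h2 ⟨Or.inl hxy, hyd⟩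
    rcases h3 with ⟨h5, h3⟩ | ⟨h5, h3⟩
    · have := h3 x h2; have := h3 y h4; omega
    · have := h3 x h2; have := h3 y h4; omega

theorem not_arc_of_pos (T : CambrianTree n) {p : Fin n → ℤ} (hp : ∀ i j, T.arc i j → p i < p j)
    {x y b : Fin n} (hxy : T.arc x y) (hb : T.sign b = true) (hbx : p b < p x)
    (hsep : (x < b ∧ b < y) ∨ (y < b ∧ b < x)) : False :=
  T.dual.not_arc_of_neg (p := fun i => - p i) (x := y) (y := x) (b := b)
    (fun i j hij => neg_lt_neg (hp _ _ hij)) hxy (by simpa [dual] using hb) (neg_lt_neg hbx)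
    hsep.symm

end CambrianTree
end Cambrian

/-! ### Invariance of linear extensions under the Cambrian congruence -/

namespace Cambrian
open Relation

theorem SignedPerm.eq_of_fst_eq (τ : SignedPerm) {x y : ℕ × Bool} (hx : x ∈ τ.word)
    (hy : y ∈ τ.word) (h : x.1 = y.1) : x = y :=
  List.inj_on_of_nodup_map τ.nodup_values hx hy h

theorem SignedPerm.size_eq_of_perm {σ σ' : SignedPerm} (h : σ.word.Perm σ'.word) :
    σ.size = σ'.size := h.length_eq

theorem idxOf_swap {l U V : List ℕ} {x y : ℕ} (hl : l = U ++ x :: y :: V) (hnd : l.Nodup) :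
    l.idxOf x = U.length ∧ l.idxOf y = U.length + 1 ∧ (∀ z ∈ U, l.idxOf z = U.idxOf z) ∧
      (∀ z ∈ U, U.idxOf z < U.length) ∧
      ∀ z, z ≠ x → z ≠ y → z ∉ U → l.idxOf z = U.length + 2 + V.idxOf z := by
  subst hl
  rw [List.nodup_append] at hnd
  simp only [List.nodup_cons, List.mem_cons, not_or] at hnd
  have hx : x ∉ U := fun h => hnd.2.2 x h x (Or.inl rfl) rfl
  have hy : y ∉ U := fun h => hnd.2.2 y h y (Or.inr (Or.inl rfl)) rfl
  refine ⟨?_, ?_, ?_, ?_, ?_⟩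
  · rw [List.idxOf_append_of_notMem hx]; simp
  · rw [List.idxOf_append_of_notMem hy, List.idxOf_cons_ne _ hnd.2.1.1.1]; simp
  · intro z hz
    rw [List.idxOf_append_of_mem hz]
  · intro z hz
    exact List.idxOf_lt_length_iff.2 hz
  · intro z hzx hzy hzU
    rw [List.idxOf_append_of_notMem hzU, List.idxOf_cons_ne _ (Ne.symm hzx),
      List.idxOf_cons_ne _ (Ne.symm hzy)]
    omega

namespace CambrianTree

variable {n : ℕ}

theorem sign_eq_of_mem {T : CambrianTree n} {τ : SignedPerm} (h : τ ∈ T.linearExtensions)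
    {x : ℕ × Bool} (hx : x ∈ τ.word) (hn : x.1 < n) : T.sign ⟨x.1, hn⟩ = x.2 :=
  congrArg Prod.snd (τ.eq_of_fst_eq (h.2.1 ⟨x.1, hn⟩) hx rfl)

/-- Swapping two adjacent letters can violate only an arc between them, and the witness `b` forbids
that arc by `not_arc_of_neg` or `not_arc_of_pos`. The order of `x` and `y` is left open so that the
lemma applies to a rewriting step in both directions. -/
theorem exchange_mem_linearExtensions {T : CambrianTree n} {σ σ' : SignedPerm}
    (h : σ ∈ T.linearExtensions) {U V : List (ℕ × Bool)} {x y b : ℕ × Bool}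
    (hσ : σ.word = U ++ x :: y :: V) (hσ' : σ'.word = U ++ y :: x :: V)
    (hb : (x.1 < b.1 ∧ b.1 < y.1) ∨ (y.1 < b.1 ∧ b.1 < x.1))
    (hs : (b ∈ V ∧ b.2 = false) ∨ (b ∈ U ∧ b.2 = true)) : σ' ∈ T.linearExtensions := by
  have hperm : σ.word.Perm σ'.word := by
    rw [hσ, hσ']; exact (List.Perm.swap _ _ _).append_left _
  have hlt : ∀ z ∈ σ.word, z.1 < n := fun z hz => by
    have := σ.fst_lt z hz; rwa [h.1] at this
  have hbm : b ∈ σ.word := by rw [hσ]; rcases hs with hs | hs <;> simp [hs.1]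
  have hxm : x ∈ σ.word := by simp [hσ]
  have hym : y ∈ σ.word := by simp [hσ]
  have hsb := sign_eq_of_mem h hbm (hlt b hbm)
  obtain ⟨h1, h2, h3, h4, h5⟩ := idxOf_swap (l := σ.word.map Prod.fst) (U := U.map Prod.fst)
    (V := V.map Prod.fst) (x := x.1) (y := y.1) (by simp [hσ]) σ.nodup_values
  obtain ⟨h1', h2', h3', h4', h5'⟩ := idxOf_swap (l := σ'.word.map Prod.fst) (U := U.map Prod.fst)
    (V := V.map Prod.fst) (x := y.1) (y := x.1) (by simp [hσ']) σ'.nodup_values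
  have hp : ∀ i j, T.arc i j → ((σ.word.map Prod.fst).idxOf (i : ℕ) : ℤ) <
      (σ.word.map Prod.fst).idxOf (j : ℕ) := fun i j hij => by exact_mod_cast h.2.2 i j hij
  have hno : ¬ T.arc ⟨x.1, hlt x hxm⟩ ⟨y.1, hlt y hym⟩ := by
    intro harc
    rcases hs with ⟨hb1, hb2⟩ | ⟨hb1, hb2⟩
    · refine T.not_arc_of_neg hp harc (b := ⟨b.1, hlt b hbm⟩) (by rw [hsb, hb2]) ?_ ?_
      · have hbU : b.1 ∉ U.map Prod.fst := by
          intro hbU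
          have := σ.nodup_values
          rw [hσ, List.map_append, List.nodup_append] at this
          exact this.2.2 _ hbU b.1 (List.mem_map_of_mem (f := Prod.fst) (by simp [hb1])) rfl
        have := h5 b.1 (by omega) (by omega) hbU
        simp only; omega
      · simpa using hb
    · refine T.not_arc_of_pos hp harc (b := ⟨b.1, hlt b hbm⟩) (by rw [hsb, hb2]) ?_ ?_
      · have hbU := List.mem_map_of_mem (f := Prod.fst) hb1
        have := h3 _ hbU; have := h4 _ hbU
        simp only; omega
      · simpa using hb
  refine ⟨(SignedPerm.size_eq_of_perm hperm).symm.trans h.1,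
    fun v => hperm.mem_iff.1 (h.2.1 v), fun i j hij => ?_⟩
  have hij0 := h.2.2 i j hij
  have hne : ¬ ((i : ℕ) = x.1 ∧ (j : ℕ) = y.1) := by
    rintro ⟨hi, hj⟩
    apply hno
    convert hij
    · exact hi.symm
    · exact hj.symm
  have hne' : ¬ ((i : ℕ) = y.1 ∧ (j : ℕ) = x.1) := by
    rintro ⟨hi, hj⟩
    rw [hi, hj] at hij0
    omega
  have hij' : (i : ℕ) ≠ j := fun he => by rw [he] at hij0; omega
  generalize (i : ℕ) = i at *
  generalize (j : ℕ) = j at *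
  by_cases hi : i ∈ U.map Prod.fst
  · by_cases hj : j ∈ U.map Prod.fst
    · have := h3 i hi; have := h3' i hi; have := h3 j hj; have := h3' j hj; omega
    · have := h3' i hi; have := h4 i hi
      by_cases hjx : j = x.1
      · subst hjx; omega
      · by_cases hjy : j = y.1
        · subst hjy; omega
        · have := h5' j hjy hjx hj; omega
  · by_cases hj : j ∈ U.map Prod.fst
    · have := h3 j hj; have := h4 j hj
      by_cases hix : i = x.1
      · subst hix; omega
      · by_cases hiy : i = y.1
        · subst hiy; omega
        · have := h5 i hix hiy hi; omega
    · have a1 := h5 i; have a2 := h5' i; have a3 := h5 j; have a4 := h5' j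
      by_cases hix : i = x.1
      · subst hix
        have hjy : j ≠ y.1 := fun he => hne ⟨rfl, he⟩
        have := a4 hjy hij'.symm hj
        omega
      · by_cases hiy : i = y.1
        · subst hiy
          have hjx : j ≠ x.1 := fun he => hne' ⟨rfl, he⟩
          have := a4 hij'.symm hjx hj
          omega
        · have := a1 hix hiy hi; have := a2 hiy hix hi
          by_cases hjx : j = x.1
          · subst hjx; omega
          · by_cases hjy : j = y.1
            · subst hjy; omega
            · have := a3 hjx hjy hj; have := a4 hjy hjx hj; omega

end CambrianTree

/-! ### The rewriting rule and its minimal words -/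

/-- One step of the rewriting rule of the Cambrian congruence: the adjacent letters `c a` become
`a c` when some letter `b` with `a < b < c` is negative and to their right, or positive and to their
left. -/
def Reduces (w w' : List (ℕ × Bool)) : Prop :=
  ∃ (U V : List (ℕ × Bool)) (a b c : ℕ × Bool), w = U ++ c :: a :: V ∧ w' = U ++ a :: c :: V ∧
    a.1 < b.1 ∧ b.1 < c.1 ∧ ((b ∈ V ∧ b.2 = false) ∨ (b ∈ U ∧ b.2 = true))

/-- A word that cannot be reduced. -/
def IsMinimal (w : List (ℕ × Bool)) : Prop := ∀ w', ¬ Reduces w w'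

theorem Reduces.perm {w w' : List (ℕ × Bool)} (h : Reduces w w') : w.Perm w' := by
  obtain ⟨U, V, a, b, c, rfl, rfl, -⟩ := h
  exact (List.Perm.swap _ _ _).append_left _

/-- The number of inversions of a word. -/
def inversions : List (ℕ × Bool) → ℕ
  | [] => 0
  | x :: w => w.countP (fun y => y.1 < x.1) + inversions w

theorem inversions_swap (U V : List (ℕ × Bool)) (a c : ℕ × Bool) (h : a.1 < c.1) :
    inversions (U ++ c :: a :: V) = inversions (U ++ a :: c :: V) + 1 := by
  induction U with
  | nil => simp [inversions, h, h.not_gt]; omega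
  | cons x U ih =>
    simp only [List.cons_append, inversions, ih, List.countP_append, List.countP_cons]
    omega

theorem Reduces.inversions {w w' : List (ℕ × Bool)} (h : Reduces w w') :
    inversions w = inversions w' + 1 := by
  obtain ⟨U, V, a, b, c, rfl, rfl, h1, h2, -⟩ := h
  exact inversions_swap U V a c (h1.trans h2)

/-- A word in which the entries `x … y` pass from above `d` to below `d` has a descent across
`d`. -/
theorem exists_descent {x y d : ℕ} {X Y : ℕ × Bool} (B C : List (ℕ × Bool)) (hX : X.1 = x)
    (hY : Y.1 = y) (hdx : d < x) (hyd : y < d) (hd : ∀ z ∈ B, z.1 ≠ d) :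
    ∃ U V a c, X :: B ++ Y :: C = U ++ c :: a :: V ∧ a.1 < d ∧ d < c.1 ∧ ∀ z ∈ C, z ∈ V := by
  induction B generalizing X x with
  | nil => exact ⟨[], C, Y, X, rfl, by omega, by omega, fun z hz => hz⟩
  | cons z B ih =>
    rcases lt_or_gt_of_ne (hd z (by simp)) with h | h
    · exact ⟨[], B ++ Y :: C, z, X, rfl, h, by omega, fun z hz => by simp [hz]⟩
    · obtain ⟨U, V, a, c, h1, h2⟩ := ih (X := z) rfl h fun z hz => hd z (by simp [hz])
      refine ⟨X :: U, V, a, c, ?_, h2⟩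
      simp only [List.cons_append] at h1 ⊢
      rw [h1]

theorem idxOf_lt_iff_of_split {w A B : List (ℕ × Bool)} (hnd : (w.map Prod.fst).Nodup)
    {X Y : ℕ × Bool} (hw : w = A ++ X :: B) (hY : Y ∈ w) :
    ((w.map Prod.fst).idxOf X.1 < (w.map Prod.fst).idxOf Y.1 → Y ∈ B) ∧
      ((w.map Prod.fst).idxOf Y.1 < (w.map Prod.fst).idxOf X.1 → Y ∈ A) := by
  subst hw
  have hXA : X.1 ∉ A.map Prod.fst := by
    intro hXA
    rw [List.map_append, List.nodup_append] at hnd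
    exact hnd.2.2 _ hXA X.1 (by simp) rfl
  have hX : ((A ++ X :: B).map Prod.fst).idxOf X.1 = A.length := by
    rw [List.map_append, List.idxOf_append_of_notMem hXA]; simp
  have hYA : Y.1 ∈ A.map Prod.fst → ((A ++ X :: B).map Prod.fst).idxOf Y.1 < A.length := by
    intro h
    rw [List.map_append, List.idxOf_append_of_mem h]
    simpa using List.idxOf_lt_length_iff.2 h
  have hYA' : Y.1 ∉ A.map Prod.fst → A.length ≤ ((A ++ X :: B).map Prod.fst).idxOf Y.1 := by
    intro h
    rw [List.map_append, List.idxOf_append_of_notMem h]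
    simp
  constructor
  · intro h
    rcases List.mem_append.1 hY with h1 | h1
    · have := hYA (List.mem_map_of_mem (f := Prod.fst) h1); omega
    · rcases List.mem_cons.1 h1 with rfl | h1
      · omega
      · exact h1
  · intro h
    rcases List.mem_append.1 hY with h1 | h1
    · exact h1
    · have : Y.1 ∉ A.map Prod.fst := by
        intro hYA
        rw [List.map_append, List.nodup_append] at hnd
        exact hnd.2.2 _ hYA Y.1 (List.mem_map_of_mem (f := Prod.fst) h1) rfl
      have := hYA' this
      omega

/-- A word with entries `x … y` on either side of `d` is not minimal if `d` is negative and to the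
right of `y`, or positive and to the left of `x`. -/
theorem IsMinimal.not_separated {τ : SignedPerm} (hm : IsMinimal τ.word) {X Y D : ℕ × Bool}
    (hX : X ∈ τ.word) (hY : Y ∈ τ.word) (hD : D ∈ τ.word)
    (hXY : (τ.word.map Prod.fst).idxOf X.1 < (τ.word.map Prod.fst).idxOf Y.1)
    (hDX : D.1 < X.1) (hYD : Y.1 < D.1)
    (hs : (D.2 = false ∧ (τ.word.map Prod.fst).idxOf Y.1 < (τ.word.map Prod.fst).idxOf D.1) ∨
      (D.2 = true ∧ (τ.word.map Prod.fst).idxOf D.1 < (τ.word.map Prod.fst).idxOf X.1)) : False := by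
  obtain ⟨A, R, hA⟩ := List.append_of_mem hX
  have hYR := (idxOf_lt_iff_of_split τ.nodup_values hA hY).1 hXY
  obtain ⟨B, C, rfl⟩ := List.append_of_mem hYR
  have hA' : τ.word = (A ++ X :: B) ++ Y :: C := by rw [hA]; simp
  have hB : ∀ z ∈ B, z.1 ≠ D.1 := by
    intro z hz he
    have hzm : z ∈ τ.word := by rw [hA]; simp [hz]
    obtain rfl := τ.eq_of_fst_eq hzm hD he
    have hnd : τ.word.Nodup := List.Nodup.of_map _ τ.nodup_values
    rcases hs with ⟨-, hs⟩ | ⟨-, hs⟩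
    · have := (idxOf_lt_iff_of_split τ.nodup_values hA' hD).1 hs
      rw [hA', List.nodup_append] at hnd
      exact hnd.2.2 z (by simp [hz]) z (by simp [this]) rfl
    · have := (idxOf_lt_iff_of_split τ.nodup_values hA hD).2 hs
      rw [hA, List.nodup_append] at hnd
      exact hnd.2.2 z this z (by simp [hz]) rfl
  obtain ⟨U, V, a, c, h1, h2, h3, h4⟩ := exists_descent (X := X) (Y := Y) B C rfl rfl hDX hYD hB
  refine hm (A ++ U ++ a :: c :: V) ⟨A ++ U, V, a, D, c, ?_, rfl, h2, h3, ?_⟩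
  · rw [hA, List.append_assoc, ← h1]; rfl
  · rcases hs with ⟨hs, hD'⟩ | ⟨hs, hD'⟩
    · exact Or.inl ⟨h4 _ ((idxOf_lt_iff_of_split τ.nodup_values hA' hD).1 hD'), hs⟩
    · exact Or.inr ⟨List.mem_append_left _
        ((idxOf_lt_iff_of_split τ.nodup_values hA hD).2 hD'), hs⟩

namespace CambrianTree

variable {n : ℕ}

/-- In a minimal linear extension, the values of an inversion are comparable in the tree. -/
theorem transGen_of_inversion {T : CambrianTree n} {τ : SignedPerm} (h : τ ∈ T.linearExtensions)
    (hm : IsMinimal τ.word) {x y : Fin n} (hyx : y < x)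
    (hxy : (τ.word.map Prod.fst).idxOf (x : ℕ) < (τ.word.map Prod.fst).idxOf (y : ℕ)) :
    TransGen T.arc x y := by
  -- Induction on the larger value of the inversion: a turning point `d` satisfies `y < d < x` and
  -- takes the place of `x`.
  obtain ⟨k, hk⟩ : ∃ k, (x : ℕ) = k := ⟨_, rfl⟩
  induction k using Nat.strong_induction_on generalizing x with
  | _ k ih =>
    have hp : ∀ i j, T.arc i j → ((τ.word.map Prod.fst).idxOf (i : ℕ) : ℤ) <
      (τ.word.map Prod.fst).idxOf (j : ℕ) := fun i j hij => by exact_mod_cast h.2.2 i j hij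
    have hX := h.2.1 x
    have hY := h.2.1 y
    rcases T.comparable_or_turn hyx.ne' with h1 | h1 | ⟨d, u', h1, h2, h3⟩
    · exact h1
    · have := T.transGen_lt hp h1; omega
    · have hdx : d < x ∧ y < d := by
        rcases h3 with h3 | h3
        · have := h3.2 y h2; omega
        · exact ⟨h3.1, h3.2 y h2⟩
      have hD := h.2.1 d
      rcases h1 with ⟨hs, h1⟩ | ⟨hs, h1⟩
      -- A negative turning point lies above `x`. If it precedes `y`, it forms a smaller inversion
      -- with `y`; if it follows `y`, it makes the word reducible.
      · have hxd := T.transGen_lt hp h1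
        rcases lt_trichotomy ((τ.word.map Prod.fst).idxOf (d : ℕ))
          ((τ.word.map Prod.fst).idxOf (y : ℕ)) with h4 | h4 | h4
        · exact h1.trans (ih d (by omega) hdx.2 h4 rfl)
        · have := (List.idxOf_inj (List.mem_map_of_mem (f := Prod.fst) hD)).1 h4
          simp only at this; omega
        · exact (hm.not_separated hX hY hD hxy hdx.1 hdx.2 (Or.inl ⟨hs, h4⟩)).elim
      · have hxd := T.transGen_lt hp h1
        exact (hm.not_separated hX hY hD hxy hdx.1 hdx.2 (Or.inr ⟨hs, Int.ofNat_lt.1 hxd⟩)).elim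

/-- An inversion of one minimal extension is forced by the tree, hence is an inversion of the other.
Both words therefore order every pair of letters alike. -/
theorem eq_of_isMinimal {T : CambrianTree n} {σ τ : SignedPerm} (hσ : σ ∈ T.linearExtensions)
    (hτ : τ ∈ T.linearExtensions) (hmσ : IsMinimal σ.word) (hmτ : IsMinimal τ.word) : σ = τ := by
  have key : ∀ (σ τ : SignedPerm), σ ∈ T.linearExtensions → τ ∈ T.linearExtensions →
      IsMinimal σ.word → IsMinimal τ.word → ∀ x y : Fin n,
      (σ.word.map Prod.fst).idxOf (x : ℕ) < (σ.word.map Prod.fst).idxOf (y : ℕ) →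
      (τ.word.map Prod.fst).idxOf (x : ℕ) < (τ.word.map Prod.fst).idxOf (y : ℕ) := by
    intro σ τ hσ hτ hmσ hmτ x y hxy
    have hpσ : ∀ i j, T.arc i j → ((σ.word.map Prod.fst).idxOf (i : ℕ) : ℤ) <
      (σ.word.map Prod.fst).idxOf (j : ℕ) := fun i j hij => by exact_mod_cast hσ.2.2 i j hij
    have hpτ : ∀ i j, T.arc i j → ((τ.word.map Prod.fst).idxOf (i : ℕ) : ℤ) <
      (τ.word.map Prod.fst).idxOf (j : ℕ) := fun i j hij => by exact_mod_cast hτ.2.2 i j hij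
    rcases lt_trichotomy x y with h | rfl | h
    · by_contra hcon
      rcases (not_lt.1 hcon).lt_or_eq with h1 | h1
      · have := T.transGen_lt hpσ (transGen_of_inversion hτ hmτ h h1)
        omega
      · have := (List.idxOf_inj (List.mem_map_of_mem (f := Prod.fst) (hτ.2.1 y))).1 h1
        simp only at this; omega
    · omega
    · have := T.transGen_lt hpτ (transGen_of_inversion hσ hmσ h hxy)
      omega
  have hval : ∀ (σ : SignedPerm), σ ∈ T.linearExtensions → ∀ x ∈ σ.word, x.1 < n :=
    fun σ hσ x hx => by have := σ.fst_lt x hx; rwa [hσ.1] at this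
  have hsub : ∀ (σ τ : SignedPerm), σ ∈ T.linearExtensions → τ ∈ T.linearExtensions →
      ∀ x ∈ σ.word, x ∈ τ.word := by
    intro σ τ hσ hτ x hx
    have h1 := sign_eq_of_mem hσ hx (hval σ hσ x hx)
    have h2 := hτ.2.1 ⟨x.1, hval σ hσ x hx⟩
    rwa [h1] at h2
  have hperm : σ.word.Perm τ.word :=
    (List.perm_ext_iff_of_nodup (List.Nodup.of_map _ σ.nodup_values)
      (List.Nodup.of_map _ τ.nodup_values)).2 fun x => ⟨hsub σ τ hσ hτ x, hsub τ σ hτ hσ x⟩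
  have hpw : ∀ (σ : SignedPerm), σ.word.Pairwise fun x y =>
      (σ.word.map Prod.fst).idxOf x.1 < (σ.word.map Prod.fst).idxOf y.1 := by
    intro σ
    rw [List.pairwise_iff_getElem]
    intro i j hi hj hij
    have h1 : ∀ k (hk : k < σ.word.length), (σ.word.map Prod.fst).idxOf (σ.word[k]).1 = k := by
      intro k hk
      have := σ.nodup_values.idxOf_getElem k (by simpa using hk)
      simpa using this
    rw [h1, h1]
    exact hij
  apply SignedPerm.word_injective
  refine hperm.eq_of_pairwise (le := fun x y => (σ.word.map Prod.fst).idxOf x.1 <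
    (σ.word.map Prod.fst).idxOf y.1) (fun x y _ _ hxy hyx => by omega) (hpw σ) ?_
  refine (hpw τ).imp_of_mem fun {x y} hx hy hxy => ?_
  exact key τ σ hτ hσ hmτ hmσ ⟨x.1, hval τ hτ x hx⟩ ⟨y.1, hval τ hτ y hy⟩ hxy

end CambrianTree
end Cambrian

namespace Cambrian
open Relation

/-! ### Normal forms -/

theorem Reduces.mem_linearExtensions_iff {n : ℕ} {T : CambrianTree n} {σ σ' : SignedPerm}
    (h : Reduces σ.word σ'.word) : σ ∈ T.linearExtensions ↔ σ' ∈ T.linearExtensions := by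
  obtain ⟨U, V, a, b, c, h1, h2, h3, h4, h5⟩ := h
  exact ⟨fun h => CambrianTree.exchange_mem_linearExtensions h h1 h2 (Or.inr ⟨h3, h4⟩) h5,
    fun h => CambrianTree.exchange_mem_linearExtensions h h2 h1 (Or.inl ⟨h3, h4⟩) h5⟩

theorem perm_range_of_reduces (σ : SignedPerm) {w : List (ℕ × Bool)} (h : Reduces σ.word w) :
    (w.map Prod.fst).Perm (List.range w.length) := by
  rw [← h.perm.length_eq]
  exact (h.perm.symm.map _).trans σ.perm

namespace SignedPerm

/-- Rewriting terminates because each step removes exactly one inversion. -/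
theorem exists_normalForm (τ : SignedPerm) :
    ∃ m, ReflTransGen (fun σ σ' : SignedPerm => Reduces σ.word σ'.word) τ m ∧
      IsMinimal m.word := by
  obtain ⟨k, hk⟩ : ∃ k, inversions τ.word = k := ⟨_, rfl⟩
  induction k using Nat.strong_induction_on generalizing τ with
  | _ k ih =>
    by_cases hm : IsMinimal τ.word
    · exact ⟨τ, .refl, hm⟩
    · simp only [IsMinimal, not_forall, not_not] at hm
      obtain ⟨w, hw⟩ := hm
      obtain ⟨m, h1, h2⟩ := ih (inversions w) (by have := hw.inversions; omega)
        ⟨w, perm_range_of_reduces τ hw⟩ rfl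
      exact ⟨m, .head hw h1, h2⟩

/-- A minimal signed permutation obtained from `τ` by reductions. -/
noncomputable def normalForm (τ : SignedPerm) : SignedPerm := τ.exists_normalForm.choose

theorem reduces_normalForm (τ : SignedPerm) :
    ReflTransGen (fun σ σ' : SignedPerm => Reduces σ.word σ'.word) τ τ.normalForm :=
  τ.exists_normalForm.choose_spec.1

theorem isMinimal_normalForm (τ : SignedPerm) : IsMinimal τ.normalForm.word :=
  τ.exists_normalForm.choose_spec.2

theorem mem_iff_of_reflTransGen {n : ℕ} (T : CambrianTree n) {σ τ : SignedPerm}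
    (h : ReflTransGen (fun σ σ' : SignedPerm => Reduces σ.word σ'.word) σ τ) :
    σ ∈ T.linearExtensions ↔ τ ∈ T.linearExtensions := by
  induction h with
  | refl => rfl
  | tail _ h ih => exact ih.trans h.mem_linearExtensions_iff

/-- The linear extensions of a tree are the signed permutations with a given normal form. -/
theorem mem_linearExtensions_iff {n : ℕ} {T : CambrianTree n} {σ : SignedPerm}
    (hσ : σ ∈ T.linearExtensions) (τ : SignedPerm) :
    τ ∈ T.linearExtensions ↔ τ.normalForm = σ.normalForm := by
  have hσ' := (mem_iff_of_reflTransGen T σ.reduces_normalForm).1 hσ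
  constructor
  · intro hτ
    have hτ' := (mem_iff_of_reflTransGen T τ.reduces_normalForm).1 hτ
    exact CambrianTree.eq_of_isMinimal hτ' hσ' τ.isMinimal_normalForm σ.isMinimal_normalForm
  · intro h
    rw [mem_iff_of_reflTransGen T τ.reduces_normalForm, h]
    exact hσ'

/-- This replaces confluence: a tree having `σ` as a linear extension also has `τ`, and its minimal
linear extension is unique. -/
theorem normalForm_eq_of_reflTransGen {σ τ : SignedPerm}
    (h : ReflTransGen (fun σ σ' : SignedPerm => Reduces σ.word σ'.word) σ τ) :
    τ.normalForm = σ.normalForm := by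
  obtain ⟨T, hT⟩ := exists_mem_linearExtensions σ
  exact (mem_linearExtensions_iff hT τ).1 ((mem_iff_of_reflTransGen T h).1 hT)

theorem normalForm_of_isMinimal {τ : SignedPerm} (h : IsMinimal τ.word) : τ.normalForm = τ := by
  rcases ReflTransGen.cases_head τ.reduces_normalForm with h1 | ⟨σ, h1, -⟩
  · exact h1.symm
  · exact (h _ h1).elim

theorem normalForm_eq_or_inversions_lt (τ : SignedPerm) : τ = τ.normalForm ∨
    (τ.size = τ.normalForm.size ∧ inversions τ.normalForm.word < inversions τ.word) := by
  have h := τ.reduces_normalForm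
  generalize τ.normalForm = m at h ⊢
  induction h with
  | refl => exact Or.inl rfl
  | tail _ h ih =>
    right
    have := h.inversions
    have hs := size_eq_of_perm h.perm
    rcases ih with rfl | ih
    · exact ⟨hs, by omega⟩
    · exact ⟨ih.1.trans hs, by omega⟩

theorem size_normalForm (τ : SignedPerm) : τ.normalForm.size = τ.size := by
  rcases τ.normalForm_eq_or_inversions_lt with h | h
  · rw [← h]
  · exact h.1.symm

/-! ### Restrictions to small and to large values -/

theorem perm_range_length {l : List ℕ} (hl : l.Nodup) {m : ℕ} (h : ∀ x, x ∈ l ↔ x < m) :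
    l.Perm (List.range l.length) := by
  have : l.Perm (List.range m) :=
    (List.perm_ext_iff_of_nodup hl List.nodup_range).2 fun x => by simp [h]
  have hm := this.length_eq
  rw [List.length_range] at hm
  rwa [hm]

/-- The restriction of a signed permutation to the values less than `k`. -/
def lo (k : ℕ) (σ : SignedPerm) : SignedPerm where
  word := σ.word.filter fun x => decide (x.1 < k)
  perm := by
    rw [← List.length_map (f := Prod.fst)]
    refine perm_range_length (m := min k σ.size)
      (σ.nodup_values.sublist (List.filter_sublist.map _)) fun x => ?_
    rw [lt_min_iff, ← σ.mem_values_iff]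
    simp [and_comm]

/-- The restriction of a signed permutation to the values at least `k`, shifted down by `k`. -/
def hi (k : ℕ) (σ : SignedPerm) : SignedPerm where
  word := (σ.word.filter fun x => !decide (x.1 < k)).map fun x => (x.1 - k, x.2)
  perm := by
    rw [← List.length_map (f := Prod.fst)]
    refine perm_range_length (m := σ.size - k) ?_ fun x => ?_
    · rw [List.map_map]
      have := σ.nodup_values.sublist
        (List.filter_sublist (p := fun x : ℕ × Bool => !decide (x.1 < k)).map Prod.fst)
      have h2 := List.Nodup.map_on (f := fun x => x - k) ?_ this
      · rwa [List.map_map] at h2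
      · simp only [List.mem_map, List.mem_filter]
        rintro _ ⟨x, ⟨-, hx⟩, rfl⟩ _ ⟨y, ⟨-, hy⟩, rfl⟩ h
        simp at hx hy
        omega
    · have : x < σ.size - k ↔ x + k < σ.size := by omega
      rw [this, ← σ.mem_values_iff]
      simp only [List.mem_map, List.mem_filter]
      constructor
      · rintro ⟨_, ⟨y, ⟨hy, hk⟩, rfl⟩, rfl⟩
        simp at hk
        exact ⟨y, hy, by simp; omega⟩
      · rintro ⟨y, hy, h⟩
        exact ⟨(x, y.2), ⟨y, ⟨hy, by simp; omega⟩, by simp [h]⟩, rfl⟩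

theorem shift_hi (k : ℕ) (σ : SignedPerm) :
    shift k (σ.hi k).word = σ.word.filter fun x => !decide (x.1 < k) := by
  simp only [hi, shift, List.map_map]
  refine (List.map_congr_left ?_).trans (List.map_id _)
  intro x hx
  have : k ≤ x.1 := by simpa using (List.mem_filter.1 hx).2
  ext <;> simp [this]

/-- For each cut of its values, `σ` belongs to precisely one shifted shuffle. This turns products
into sums over cuts. -/
theorem mem_shiftedShuffle_iff (τ τ' σ : SignedPerm) :
    σ ∈ shiftedShuffle τ τ' ↔ σ.lo τ.size = τ ∧ σ.hi τ.size = τ' := by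
  rw [mem_shiftedShuffle, ← shift_hi, (shift_injective _).eq_iff, SignedPerm.ext_iff,
    SignedPerm.ext_iff]
  rfl

theorem size_lo {k : ℕ} {σ : SignedPerm} (h : k ≤ σ.size) : (σ.lo k).size = k := by
  have h1 : ∀ x, x ∈ (σ.lo k).word.map Prod.fst ↔ x < k := by
    intro x
    have := σ.mem_values_iff x
    simp only [lo, List.mem_map, List.mem_filter] at this ⊢
    constructor
    · rintro ⟨y, ⟨-, hy⟩, rfl⟩; simpa using hy
    · intro hx
      obtain ⟨y, hy, rfl⟩ := this.2 (by omega)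
      exact ⟨y, ⟨hy, by simpa using hx⟩, rfl⟩
  simp only [mem_values_iff] at h1
  have := h1 k; have := h1 (σ.lo k).size
  omega

theorem size_hi {k : ℕ} {σ : SignedPerm} (h : k ≤ σ.size) : (σ.hi k).size = σ.size - k := by
  have h1 := size_of_mem_shiftedShuffle
    ((mem_shiftedShuffle_iff (σ.lo k) (σ.hi k) σ).2 (by rw [size_lo h]; exact ⟨rfl, rfl⟩))
  rw [size_lo h] at h1
  omega

/-- The shifted concatenation. -/
def append (u v : SignedPerm) : SignedPerm :=
  ⟨u.word ++ shift u.size v.word, perm_range_of_perm u v _ (List.Perm.refl _)⟩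

theorem size_append (u v : SignedPerm) : (u.append v).size = u.size + v.size := by
  simp [append, size, shift]

theorem append_mem_shiftedShuffle (u v : SignedPerm) : u.append v ∈ shiftedShuffle u v := by
  rw [mem_shiftedShuffle]
  have h1 : ∀ x ∈ u.word, x.1 < u.size := u.fst_lt
  have h2 : ∀ x ∈ shift u.size v.word, ¬ x.1 < u.size := by
    intro x hx
    simp only [shift, List.mem_map] at hx
    obtain ⟨y, -, rfl⟩ := hx
    simp
  simp only [append, List.filter_append]
  constructor
  · rw [List.filter_eq_self.2 (by simpa using h1), List.filter_eq_nil_iff.2 (by simpa using h2),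
      List.append_nil]
  · rw [List.filter_eq_nil_iff.2 (by simpa using h1), List.filter_eq_self.2 (by simpa using h2),
      List.nil_append]

theorem lo_append (u v : SignedPerm) : (u.append v).lo u.size = u :=
  ((mem_shiftedShuffle_iff _ _ _).1 (append_mem_shiftedShuffle u v)).1

theorem hi_append (u v : SignedPerm) : (u.append v).hi u.size = v :=
  ((mem_shiftedShuffle_iff _ _ _).1 (append_mem_shiftedShuffle u v)).2

end SignedPerm

/-! ### Inversions under restriction and concatenation -/

theorem inversions_map (f : ℕ → ℕ) (w : List (ℕ × Bool))
    (hf : ∀ x ∈ w, ∀ y ∈ w, f x.1 < f y.1 ↔ x.1 < y.1) :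
    inversions (w.map fun x => (f x.1, x.2)) = inversions w := by
  induction w with
  | nil => rfl
  | cons x w ih =>
    simp only [List.map_cons, inversions, List.countP_map]
    rw [ih fun x hx y hy => hf x (by simp [hx]) y (by simp [hy])]
    congr 1
    apply List.countP_congr
    intro y hy
    simpa using hf y (by simp [hy]) x (by simp)

/-- The inversions lost by splitting are those of a large letter before a small one. None is lost
exactly when all small letters come first. -/
theorem inversions_filter_add (k : ℕ) (w : List (ℕ × Bool)) :
    inversions (w.filter fun x => decide (x.1 < k)) +
        inversions (w.filter fun x => !decide (x.1 < k)) < inversions w ∨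
      (w = (w.filter fun x => decide (x.1 < k)) ++ (w.filter fun x => !decide (x.1 < k)) ∧
        inversions (w.filter fun x => decide (x.1 < k)) +
        inversions (w.filter fun x => !decide (x.1 < k)) = inversions w) := by
  induction w with
  | nil => simp [inversions]
  | cons x w ih =>
    by_cases hx : x.1 < k
    · have h1 : (w.filter fun x => decide (x.1 < k)).countP (fun y => decide (y.1 < x.1)) =
          w.countP (fun y => decide (y.1 < x.1)) := by
        rw [List.countP_filter]
        apply List.countP_congr
        intro y _
        simp; omega
      simp only [List.filter_cons, hx, decide_true, if_true, Bool.not_true, Bool.false_eq_true,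
        if_false, inversions, h1, List.cons_append, List.cons.injEq, true_and]
      rcases ih with ih | ih
      · left; omega
      · right; exact ⟨ih.1, by omega⟩
    -- A large first letter is inverted with every small letter after it; these are the lost
    -- inversions.
    · have h1 : (w.filter fun x => !decide (x.1 < k)).countP (fun y => decide (y.1 < x.1)) +
          (w.filter fun x => decide (x.1 < k)).length = w.countP (fun y => decide (y.1 < x.1)) := by
        clear ih
        induction w with
        | nil => rfl
        | cons y w ih =>
          by_cases hy : y.1 < k
          · have : y.1 < x.1 := by omega
            simp [hy, this]; omega
          · simp only [List.filter_cons, hy, decide_false, Bool.not_false, if_true,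
              Bool.false_eq_true, if_false, List.countP_cons]
            omega
      simp only [List.filter_cons, hx, decide_false, Bool.not_false, if_true, Bool.false_eq_true,
        if_false, inversions]
      rcases Nat.eq_zero_or_pos (w.filter fun x => decide (x.1 < k)).length with h0 | h0
      · rw [List.length_eq_zero_iff] at h0
        rw [h0] at h1 ih ⊢
        simp only [List.length_nil, List.nil_append, inversions] at h1 ih ⊢
        rcases ih with ih | ih
        · left; omega
        · right; exact ⟨congrArg _ ih.1, by omega⟩
      · left
        have : inversions (w.filter fun x => decide (x.1 < k)) +
          inversions (w.filter fun x => !decide (x.1 < k)) ≤ inversions w := by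
          rcases ih with ih | ih <;> omega
        omega

namespace SignedPerm

theorem inversions_hi (k : ℕ) (σ : SignedPerm) : inversions (σ.hi k).word =
    inversions (σ.word.filter fun x => !decide (x.1 < k)) :=
  inversions_map (fun x => x - k) _ fun x hx y hy => by
    have hx := (List.mem_filter.1 hx).2
    have hy := (List.mem_filter.1 hy).2
    simp at hx hy
    omega

theorem inversions_lo_add_hi_lt (k : ℕ) (σ : SignedPerm) :
    inversions (σ.lo k).word + inversions (σ.hi k).word < inversions σ.word ∨
      (σ.word = (σ.lo k).word ++ shift k (σ.hi k).word ∧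
        inversions (σ.lo k).word + inversions (σ.hi k).word = inversions σ.word) := by
  rw [inversions_hi, shift_hi]
  exact inversions_filter_add k σ.word

theorem inversions_append (u v : SignedPerm) :
    inversions (u.append v).word = inversions u.word + inversions v.word := by
  rcases (u.append v).inversions_lo_add_hi_lt u.size with h | h
  -- The strict alternative contradicts a direct count: no letter of the shifted second factor is
  -- smaller than a letter of the first.
  · exfalso
    rw [lo_append, hi_append] at h
    have : ∀ w w' : List (ℕ × Bool), (∀ x ∈ w, ∀ y ∈ w', x.1 < y.1) →
        inversions (w ++ w') = inversions w + inversions w' := by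
      intro w w' hw
      induction w with
      | nil => simp [inversions]
      | cons x w ih =>
        have h0 : w'.countP (fun y => decide (y.1 < x.1)) = 0 := by
          rw [List.countP_eq_zero]
          intro y hy
          simpa using (hw x (by simp) y hy).le
        simp only [List.cons_append, inversions, List.countP_append, h0,
          ih fun x hx => hw x (by simp [hx])]
        omega
    have h3 : inversions (u.append v).word = inversions u.word + inversions v.word := by
      rw [append, this]
      · congr 1
        exact inversions_map (fun x => x + u.size) _ fun x _ y _ => by omega
      · intro x hx y hy
        simp only [shift, List.mem_map] at hy
        obtain ⟨z, -, rfl⟩ := hy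
        have := u.fst_lt x hx
        simp only; omega
    omega
  · rw [← h.2, lo_append, hi_append]

/-- The concatenation is the unique element of the shuffle with fewest inversions, which makes it
the leading term of a product. -/
theorem eq_append_or_inversions_lt {u v σ : SignedPerm} (h : σ ∈ shiftedShuffle u v) :
    σ = u.append v ∨ inversions u.word + inversions v.word < inversions σ.word := by
  obtain ⟨h1, h2⟩ := (mem_shiftedShuffle_iff _ _ _).1 h
  rcases σ.inversions_lo_add_hi_lt u.size with h3 | h3
  · right; rwa [h1, h2] at h3
  · left; apply word_injective; rw [h3.1, h1, h2]; rfl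

end SignedPerm
end Cambrian

namespace Cambrian
open Relation

/-! ### Reductions and restrictions -/

/-- The predicate `q` selects an interval of values. If both swapped letters survive, so does the
witness between them; otherwise the swap becomes invisible. -/
theorem Reduces.filter {w w' : List (ℕ × Bool)} (h : Reduces w w') (q : ℕ → Bool)
    (hq : ∀ a b c, a < b → b < c → q a = true → q c = true → q b = true) :
    w.filter (fun x => q x.1) = w'.filter (fun x => q x.1) ∨
      Reduces (w.filter fun x => q x.1) (w'.filter fun x => q x.1) := by
  obtain ⟨U, V, a, b, c, rfl, rfl, h1, h2, h3⟩ := h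
  by_cases ha : q a.1 = true
  · by_cases hc : q c.1 = true
    · have hb := hq _ _ _ h1 h2 ha hc
      refine Or.inr ⟨U.filter fun x => q x.1, V.filter fun x => q x.1, a, b, c, ?_, ?_, h1, h2, ?_⟩
      · simp [ha, hc]
      · simp [ha, hc]
      · simpa [hb] using h3
    · left; simp [hc, List.filter_cons]
  · left; simp [ha, List.filter_cons]

theorem Reduces.map {w w' : List (ℕ × Bool)} (h : Reduces w w') (f : ℕ → ℕ)
    (hf : ∀ x ∈ w, ∀ y ∈ w, x.1 < y.1 → f x.1 < f y.1) :
    Reduces (w.map fun x => (f x.1, x.2)) (w'.map fun x => (f x.1, x.2)) := by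
  obtain ⟨U, V, a, b, c, rfl, rfl, h1, h2, h3⟩ := h
  have hb : b ∈ U ++ c :: a :: V := by rcases h3 with h3 | h3 <;> simp [h3.1]
  refine ⟨U.map fun x => (f x.1, x.2), V.map fun x => (f x.1, x.2), (f a.1, a.2), (f b.1, b.2),
    (f c.1, c.2), by simp, by simp, hf a (by simp) b hb h1, hf b hb c (by simp) h2, ?_⟩
  rcases h3 with h3 | h3
  · exact Or.inl ⟨List.mem_map.2 ⟨b, h3.1, rfl⟩, h3.2⟩
  · exact Or.inr ⟨List.mem_map.2 ⟨b, h3.1, rfl⟩, h3.2⟩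

theorem Reduces.append_left {w w' : List (ℕ × Bool)} (h : Reduces w w') (u : List (ℕ × Bool)) :
    Reduces (u ++ w) (u ++ w') := by
  obtain ⟨U, V, a, b, c, rfl, rfl, h1, h2, h3⟩ := h
  refine ⟨u ++ U, V, a, b, c, by simp, by simp, h1, h2, ?_⟩
  rcases h3 with h3 | h3
  · exact Or.inl h3
  · exact Or.inr ⟨by simp [h3.1], h3.2⟩

theorem Reduces.append_right {w w' : List (ℕ × Bool)} (h : Reduces w w') (v : List (ℕ × Bool)) :
    Reduces (w ++ v) (w' ++ v) := by
  obtain ⟨U, V, a, b, c, rfl, rfl, h1, h2, h3⟩ := h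
  refine ⟨U, V ++ v, a, b, c, by simp, by simp, h1, h2, ?_⟩
  rcases h3 with h3 | h3
  · exact Or.inl ⟨by simp [h3.1], h3.2⟩
  · exact Or.inr h3

namespace SignedPerm

theorem lo_eq_or_reduces (k : ℕ) {σ σ' : SignedPerm} (h : Reduces σ.word σ'.word) :
    σ.lo k = σ'.lo k ∨ Reduces (σ.lo k).word (σ'.lo k).word := by
  rcases h.filter (fun x => decide (x < k)) (by intro a b c; simp; omega) with h | h
  · exact Or.inl (word_injective h)
  · exact Or.inr h

theorem hi_eq_or_reduces (k : ℕ) {σ σ' : SignedPerm} (h : Reduces σ.word σ'.word) :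
    σ.hi k = σ'.hi k ∨ Reduces (σ.hi k).word (σ'.hi k).word := by
  rcases h.filter (fun x => !decide (x < k)) (by intro a b c; simp; omega) with h | h
  · exact Or.inl (word_injective (congrArg (List.map fun x : ℕ × Bool => (x.1 - k, x.2)) h))
  · refine Or.inr (h.map (fun x => x - k) fun x hx y hy hxy => ?_)
    have hx := (List.mem_filter.1 hx).2
    simp at hx
    omega

/-- Applying `f` along the rewriting of `σ` to its normal form gives a rewriting of `f σ`, possibly
with idle steps. -/
theorem normalForm_map_of (f : SignedPerm → SignedPerm) (hf : ∀ σ σ' : SignedPerm,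
    Reduces σ.word σ'.word → f σ = f σ' ∨ Reduces (f σ).word (f σ').word) (σ : SignedPerm) :
    (f σ.normalForm).normalForm = (f σ).normalForm := by
  have h := σ.reduces_normalForm
  generalize σ.normalForm = m at h ⊢
  apply normalForm_eq_of_reflTransGen
  induction h with
  | refl => exact .refl
  | tail _ h ih =>
    rcases hf _ _ h with h | h
    · rwa [← h]
    · exact ih.tail h

theorem normalForm_lo (k : ℕ) (σ : SignedPerm) :
    (σ.normalForm.lo k).normalForm = (σ.lo k).normalForm :=
  normalForm_map_of _ (fun _ _ => lo_eq_or_reduces k) σ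

theorem normalForm_hi (k : ℕ) (σ : SignedPerm) :
    (σ.normalForm.hi k).normalForm = (σ.hi k).normalForm :=
  normalForm_map_of _ (fun _ _ => hi_eq_or_reduces k) σ

/-- A reduction of the concatenation would leave both restrictions fixed, as these are minimal, and
so remain in the shuffle with fewer inversions than the concatenation, which is impossible. -/
theorem isMinimal_append {u v : SignedPerm} :
    IsMinimal (u.append v).word ↔ IsMinimal u.word ∧ IsMinimal v.word := by
  constructor
  · refine fun h => ⟨fun w hw => h _ (hw.append_right _), fun w hw => ?_⟩
    exact h _ ((hw.map (fun x => x + u.size) fun x _ y _ hxy => by omega).append_left _)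
  · rintro ⟨hu, hv⟩ w hw
    set σ : SignedPerm := ⟨w, perm_range_of_reduces _ hw⟩ with hσ
    have hw : Reduces (u.append v).word σ.word := hw
    have h1 := lo_eq_or_reduces u.size hw
    have h2 := hi_eq_or_reduces u.size hw
    rw [lo_append] at h1
    rw [hi_append] at h2
    replace h1 := h1.resolve_right (hu _)
    replace h2 := h2.resolve_right (hv _)
    have h3 := (mem_shiftedShuffle_iff u v σ).2 ⟨h1.symm, h2.symm⟩
    have h4 := hw.inversions
    rw [inversions_append] at h4
    rcases eq_append_or_inversions_lt h3 with h5 | h5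
    · rw [h5, inversions_append] at h4; omega
    · omega

theorem isMinimal_empty : IsMinimal SignedPerm.empty.word := by
  rintro w ⟨U, V, a, b, c, h, -⟩
  simp [empty] at h

theorem eq_empty_of_size {σ : SignedPerm} (h : σ.size = 0) : σ = .empty :=
  word_injective (List.length_eq_zero_iff.1 h)

end SignedPerm

/-! ### Coefficients -/

namespace FQSym

variable (K : Type*) [Field K]

theorem coord_F (σ τ : SignedPerm) : (basis K).coord σ (F K τ) = if τ = σ then 1 else 0 := by
  rw [F, Module.Basis.coord_apply, Module.Basis.repr_self, Finsupp.single_apply]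

theorem ext_coord {f g : FQSym K} (h : ∀ σ, (basis K).coord σ f = (basis K).coord σ g) : f = g :=
  (basis K).ext_elem h

/-- On basis elements, only the cut at the size of the first factor can contribute. -/
theorem coord_mul (σ : SignedPerm) (f g : FQSym K) : (basis K).coord σ (f * g) =
    ∑ k ∈ Finset.range (σ.size + 1), (basis K).coord (σ.lo k) f * (basis K).coord (σ.hi k) g := by
  have : (mulMap K).compr₂ ((basis K).coord σ) = ∑ k ∈ Finset.range (σ.size + 1),
      (LinearMap.mul K K).compl₁₂ ((basis K).coord (σ.lo k)) ((basis K).coord (σ.hi k)) := by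
    refine (basis K).ext fun τ => (basis K).ext fun τ' => ?_
    change (basis K).coord σ (F K τ * F K τ') = _
    rw [F_mul_F, map_sum]
    simp only [LinearMap.sum_apply, LinearMap.compl₁₂_apply, LinearMap.mul_apply']
    change _ = ∑ k ∈ Finset.range (σ.size + 1),
      (basis K).coord (σ.lo k) (F K τ) * (basis K).coord (σ.hi k) (F K τ')
    simp only [coord_F, Finset.sum_ite_eq', ite_mul, one_mul, zero_mul]
    by_cases h : σ ∈ shiftedShuffle τ τ'
    · have hs := size_of_mem_shiftedShuffle h
      have h' := (SignedPerm.mem_shiftedShuffle_iff _ _ _).1 h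
      rw [if_pos h, Finset.sum_eq_single τ.size, if_pos h'.1.symm, if_pos h'.2.symm]
      · intro k hk hne
        rw [if_neg]
        intro hτ
        apply hne
        rw [hτ, SignedPerm.size_lo (by simpa [Nat.lt_succ_iff] using hk)]
      · intro hk
        simp at hk
        omega
    · rw [if_neg h, Finset.sum_eq_zero]
      intro k hk
      have hk' : k ≤ σ.size := by simpa [Nat.lt_succ_iff] using hk
      by_cases h1 : τ = σ.lo k
      · rw [if_pos h1, if_neg]
        intro h2
        apply h
        have := SignedPerm.size_lo hk'
        rw [SignedPerm.mem_shiftedShuffle_iff, h1, h2, this]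
        exact ⟨rfl, rfl⟩
      · rw [if_neg h1]
  have h2 := LinearMap.congr_fun (LinearMap.congr_fun this f) g
  simp only [LinearMap.compr₂_apply, LinearMap.sum_apply, LinearMap.compl₁₂_apply,
    LinearMap.mul_apply'] at h2
  exact h2

theorem coord_one (σ : SignedPerm) :
    (basis K).coord σ (1 : FQSym K) = if SignedPerm.empty = σ then 1 else 0 :=
  coord_F K σ .empty

end FQSym

/-! ### The Cambrian algebra as the elements constant on classes -/

variable (K : Type*) [Field K]

open FQSym

/-- The subalgebra of elements whose coefficients are constant on Cambrian classes. -/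
noncomputable def cambAlgebra : Subalgebra K (FQSym K) where
  carrier := {f | ∀ σ, (basis K).coord σ f = (basis K).coord σ.normalForm f}
  mul_mem' {f g} hf hg σ := by
    rw [coord_mul, coord_mul, σ.size_normalForm]
    refine Finset.sum_congr rfl fun k _ => ?_
    rw [hf, ← σ.normalForm_lo, ← hf, hg, ← σ.normalForm_hi, ← hg]
  add_mem' {f g} hf hg σ := by rw [map_add, map_add, hf, hg]
  algebraMap_mem' r σ := by
    rw [Algebra.algebraMap_eq_smul_one, map_smul, map_smul, coord_one, coord_one]
    have : SignedPerm.empty = σ ↔ SignedPerm.empty = σ.normalForm := by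
      constructor
      · rintro rfl
        exact (SignedPerm.eq_empty_of_size (SignedPerm.size_normalForm _)).symm
      · intro h
        refine (SignedPerm.eq_empty_of_size ?_).symm
        rw [← SignedPerm.size_normalForm, ← h]; rfl
    simp only [this]

open Classical in
theorem coord_P {n : ℕ} (T : CambrianTree n) (σ : SignedPerm) :
    (basis K).coord σ (T.P K) = if σ ∈ T.linearExtensions then 1 else 0 := by
  simp only [CambrianTree.P, map_sum, coord_F, Finset.sum_ite_eq', Set.Finite.mem_toFinset]

/-- The sum of `F τ` over the Cambrian class of `σ`. -/
noncomputable def classSum (σ : SignedPerm) : FQSym K :=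
  (exists_mem_linearExtensions σ).choose.P K

theorem coord_classSum (σ τ : SignedPerm) :
    (basis K).coord τ (classSum K σ) = if τ.normalForm = σ.normalForm then 1 else 0 := by
  classical
  rw [classSum, coord_P]
  congr 1
  exact propext (SignedPerm.mem_linearExtensions_iff (exists_mem_linearExtensions σ).choose_spec τ)

theorem classSum_mem (σ : SignedPerm) : classSum K σ ∈ cambAlgebra K := by
  intro τ
  rw [coord_classSum, coord_classSum,
    SignedPerm.normalForm_of_isMinimal τ.isMinimal_normalForm]

theorem classSum_mem_homogeneous (σ : SignedPerm) : classSum K σ ∈ homogeneous K σ.size := by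
  refine Submodule.sum_mem _ fun τ hτ => Submodule.subset_span ⟨τ, ?_, rfl⟩
  rw [Set.Finite.mem_toFinset] at hτ
  exact hτ.1

/-- An element constant on classes is determined by its coefficients at the minimal representatives.
The nonvanishing clause later locates the terms of a difference. -/
theorem exists_eq_sum_classSum {f : FQSym K} (hf : f ∈ cambAlgebra K) :
    ∃ s : Finset SignedPerm, (∀ m ∈ s, IsMinimal m.word ∧ (basis K).coord m f ≠ 0) ∧
      f = ∑ m ∈ s, (basis K).coord m f • classSum K m := by
  classical
  refine ⟨((basis K).repr f).support.filter fun m => IsMinimal m.word, ?_, ?_⟩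
  · intro m hm
    rw [Finset.mem_filter, Finsupp.mem_support_iff] at hm
    exact ⟨hm.2, hm.1⟩
  · refine ext_coord K fun σ => ?_
    simp only [map_sum, map_smul, coord_classSum, smul_eq_mul, mul_ite, mul_one, mul_zero]
    rw [hf σ]
    by_cases h0 : (basis K).coord σ.normalForm f = 0
    · rw [h0, Finset.sum_eq_zero]
      intro m hm
      rw [Finset.mem_filter] at hm
      split_ifs with h
      · rw [SignedPerm.normalForm_of_isMinimal hm.2] at h
        rw [← h, h0]
      · rfl
    · rw [Finset.sum_eq_single σ.normalForm]
      · rw [SignedPerm.normalForm_of_isMinimal σ.isMinimal_normalForm, if_pos rfl]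
      · intro m hm hne
        rw [Finset.mem_filter] at hm
        rw [if_neg]
        rw [SignedPerm.normalForm_of_isMinimal hm.2]
        exact hne.symm
      · intro h
        exact (h (Finset.mem_filter.2 ⟨Finsupp.mem_support_iff.2 h0,
          σ.isMinimal_normalForm⟩)).elim

theorem toSubmodule_cambAlgebra : Subalgebra.toSubmodule (cambAlgebra K) = Camb K := by
  apply le_antisymm
  · intro f hf
    obtain ⟨s, -, hs⟩ := exists_eq_sum_classSum K hf
    rw [hs]
    exact Submodule.sum_mem _ fun m _ => Submodule.smul_mem _ _
      (Submodule.subset_span ⟨_, _, rfl⟩)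
  · refine Submodule.span_le.2 ?_
    rintro _ ⟨n, T, rfl⟩ σ
    classical
    rw [coord_P, coord_P]
    simp only [SignedPerm.mem_iff_of_reflTransGen T σ.reduces_normalForm]

end Cambrian

namespace Cambrian

/-! ### Factorization into indecomposable signed permutations -/

namespace SignedPerm

/-- A nonempty signed permutation that is not a shifted concatenation of two nonempty ones. -/
def IsIndecomposable (u : SignedPerm) : Prop :=
  u ≠ .empty ∧ ∀ a b : SignedPerm, u = a.append b → a = .empty ∨ b = .empty

theorem size_eq_zero_iff {u : SignedPerm} : u.size = 0 ↔ u = .empty :=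
  ⟨eq_empty_of_size, by rintro rfl; rfl⟩

theorem append_empty (u : SignedPerm) : u.append .empty = u := by
  apply word_injective
  simp [append, empty, shift]

theorem append_assoc (u v w : SignedPerm) : (u.append v).append w = u.append (v.append w) := by
  apply word_injective
  simp [append, shift, size, Function.comp_def, add_comm, add_left_comm]

theorem append_left_cancel {u v w : SignedPerm} (h : u.append v = u.append w) : v = w := by
  rw [← hi_append u v, h, hi_append]

/-- If two concatenations agree, then the longer first factor has the shorter one as a prefix. -/
theorem exists_append_of_append_eq {u v u' v' : SignedPerm} (h : u.append v = u'.append v')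
    (hs : u.size ≤ u'.size) : ∃ w, u' = u.append w := by
  have hw : u.word ++ shift u.size v.word = u'.word ++ shift u'.size v'.word :=
    congrArg SignedPerm.word h
  obtain ⟨r, hr⟩ : u.word <+: u'.word :=
    List.prefix_of_prefix_length_le (List.prefix_append _ _) (hw.symm ▸ List.prefix_append _ _) hs
  refine ⟨u'.hi u.size, word_injective ?_⟩
  change _ = u.word ++ shift u.size _
  rw [shift_hi, ← hr, List.filter_append]
  have h1 : ∀ x ∈ u.word, x.1 < u.size := u.fst_lt
  have h2 : ∀ x ∈ r, ¬ x.1 < u.size := by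
    intro x hx
    rw [← hr, List.append_assoc, List.append_cancel_left_eq] at hw
    have hx' : x ∈ shift u.size v.word := by rw [hw]; simp [hx]
    simp only [shift, List.mem_map] at hx'
    obtain ⟨y, -, rfl⟩ := hx'
    simp
  rw [List.filter_eq_nil_iff.2 (by simpa using h1), List.filter_eq_self.2 (by simpa using h2),
    List.nil_append]

theorem append_inj_of_indecomposable {u v u' v' : SignedPerm} (hu : u.IsIndecomposable)
    (hu' : u'.IsIndecomposable) (h : u.append v = u'.append v') : u = u' ∧ v = v' := by
  have key : ∀ {u v u' v' : SignedPerm}, u.IsIndecomposable → u'.IsIndecomposable →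
      u.append v = u'.append v' → u.size ≤ u'.size → u = u' := by
    intro u v u' v' hu hu' h hs
    obtain ⟨w, hw⟩ := exists_append_of_append_eq h hs
    have := (hu'.2 _ _ hw).resolve_left hu.1
    rw [hw, this, append_empty]
  have huu : u = u' := by
    rcases le_total u.size u'.size with hs | hs
    · exact key hu hu' h hs
    · exact (key hu' hu h.symm hs).symm
  subst huu
  exact ⟨rfl, append_left_cancel h⟩

/-- The shifted concatenation of a list of signed permutations. -/
def concat : List SignedPerm → SignedPerm
  | [] => .empty
  | u :: l => u.append (concat l)

/-- Unique factorization: of two indecomposable first factors the shorter is a prefix factor of the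
longer, hence equal to it. -/
theorem concat_injective {l l' : List SignedPerm} (hl : ∀ u ∈ l, u.IsIndecomposable)
    (hl' : ∀ u ∈ l', u.IsIndecomposable) (h : concat l = concat l') : l = l' := by
  have hne : ∀ {u v : SignedPerm}, u.IsIndecomposable → u.append v ≠ .empty := by
    intro u v hu h
    have := congrArg size h
    rw [size_append] at this
    exact hu.1 (eq_empty_of_size (by have : SignedPerm.empty.size = 0 := rfl; omega))
  induction l generalizing l' with
  | nil =>
    cases l' with
    | nil => rfl
    | cons u l' => exact (hne (hl' u (by simp)) h.symm).elim
  | cons u l ih =>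
    cases l' with
    | nil => exact (hne (hl u (by simp)) h).elim
    | cons u' l' =>
      obtain ⟨rfl, h2⟩ := append_inj_of_indecomposable (hl u (by simp)) (hl' u' (by simp)) h
      rw [ih (fun u hu => hl u (by simp [hu])) (fun u hu => hl' u (by simp [hu])) h2]

/-- A nonempty signed permutation has an indecomposable first factor. -/
theorem exists_indecomposable_append {u : SignedPerm} (hu : u ≠ .empty) :
    ∃ a b : SignedPerm, a.IsIndecomposable ∧ u = a.append b := by
  obtain ⟨k, hk⟩ : ∃ k, u.size = k := ⟨_, rfl⟩
  induction k using Nat.strong_induction_on generalizing u with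
  | _ k ih =>
    by_cases h : u.IsIndecomposable
    · exact ⟨u, .empty, h, (append_empty u).symm⟩
    · simp only [IsIndecomposable, not_and, not_forall, not_or] at h
      obtain ⟨a, b, hab, ha, hb⟩ := h hu
      have hs := congrArg size hab
      rw [size_append] at hs
      have hb' : b.size ≠ 0 := fun h => hb (eq_empty_of_size h)
      obtain ⟨a', b', ha', hab'⟩ := ih a.size (by omega) ha rfl
      exact ⟨a', b'.append b, ha', by rw [hab, hab', append_assoc]⟩

theorem exists_concat {m : SignedPerm} (hm : IsMinimal m.word) :
    ∃ l : List SignedPerm, (∀ u ∈ l, IsMinimal u.word ∧ u.IsIndecomposable) ∧ concat l = m := by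
  obtain ⟨k, hk⟩ : ∃ k, m.size = k := ⟨_, rfl⟩
  induction k using Nat.strong_induction_on generalizing m with
  | _ k ih =>
    by_cases h0 : m = .empty
    · exact ⟨[], by simp, h0.symm⟩
    · obtain ⟨a, b, ha, rfl⟩ := exists_indecomposable_append h0
      have hab := isMinimal_append.1 hm
      rw [size_append] at hk
      have ha' : a.size ≠ 0 := fun h => ha.1 (eq_empty_of_size h)
      obtain ⟨l, hl, rfl⟩ := ih b.size (by omega) hab.2 rfl
      refine ⟨a :: l, ?_, rfl⟩
      intro u hu
      rcases List.mem_cons.1 hu with rfl | hu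
      · exact ⟨hab.1, ha⟩
      · exact hl u hu

end SignedPerm

/-! ### Leading terms -/

variable (K : Type*) [Field K]

open FQSym

/-- `f` is the sum of `F u` and of terms of the same size with more inversions. -/
def HasLeadingTerm (f : FQSym K) (u : SignedPerm) : Prop :=
  (basis K).coord u f = 1 ∧ ∀ σ, (basis K).coord σ f ≠ 0 →
    σ = u ∨ (σ.size = u.size ∧ inversions u.word < inversions σ.word)

variable {K}

/-- Sizes determine the cut. The inversions of the two restrictions add up to at most those of `σ`,
with equality only for the concatenation, so a tie occurs only at `u.append v`. -/
theorem HasLeadingTerm.mul {f g : FQSym K} {u v : SignedPerm} (hf : HasLeadingTerm K f u)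
    (hg : HasLeadingTerm K g v) : HasLeadingTerm K (f * g) (u.append v) := by
  have hsize : ∀ {f : FQSym K} {u : SignedPerm}, HasLeadingTerm K f u → ∀ σ : SignedPerm,
      σ.size ≠ u.size → (basis K).coord σ f = 0 := by
    intro f u hf σ hσ
    by_contra h
    rcases hf.2 σ h with rfl | h
    · exact hσ rfl
    · exact hσ h.1
  constructor
  · rw [coord_mul, Finset.sum_eq_single u.size, SignedPerm.lo_append, SignedPerm.hi_append, hf.1,
      hg.1, mul_one]
    · intro k hk hne
      rw [hsize hf, zero_mul]
      rwa [SignedPerm.size_lo (by simpa [Nat.lt_succ_iff] using hk)]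
    · intro h
      simp [SignedPerm.size_append] at h
  · intro σ hσ
    rw [coord_mul] at hσ
    obtain ⟨k, hk, hne⟩ := Finset.exists_ne_zero_of_sum_ne_zero hσ
    have hk' : k ≤ σ.size := by simpa [Nat.lt_succ_iff] using hk
    have h1 := hf.2 _ (left_ne_zero_of_mul hne)
    have h2 := hg.2 _ (right_ne_zero_of_mul hne)
    have hs1 : (σ.lo k).size = u.size := by
      rcases h1 with h1 | h1
      · rw [h1]
      · exact h1.1
    have hs2 : (σ.hi k).size = v.size := by
      rcases h2 with h2 | h2
      · rw [h2]
      · exact h2.1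
    have hs3 := SignedPerm.size_lo hk'
    have hs4 := SignedPerm.size_hi hk'
    have hsum : σ.size = u.size + v.size := by omega
    rw [SignedPerm.size_append, SignedPerm.inversions_append]
    have h3 := σ.inversions_lo_add_hi_lt k
    have h4 : inversions (σ.lo k).word + inversions (σ.hi k).word ≤ inversions σ.word := by
      rcases h3 with h3 | h3
      · exact h3.le
      · exact h3.2.le
    rcases h1 with h1 | h1
    · rcases h2 with h2 | h2
      · rcases h3 with h3 | h3
        · rw [h1, h2] at h3
          exact Or.inr ⟨hsum, h3⟩
        · left
          apply SignedPerm.word_injective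
          rw [h3.1, h1, h2, ← hs3, h1]
          rfl
      · right
        rw [h1] at h4
        exact ⟨hsum, by omega⟩
    · right
      have : inversions v.word ≤ inversions (σ.hi k).word := by
        rcases h2 with h2 | h2
        · rw [h2]
        · exact h2.2.le
      exact ⟨hsum, by omega⟩

theorem hasLeadingTerm_one : HasLeadingTerm K 1 .empty := by
  refine ⟨by rw [coord_one, if_pos rfl], fun σ hσ => Or.inl ?_⟩
  rw [coord_one] at hσ
  by_contra h
  exact hσ (if_neg fun h' => h h'.symm)

theorem hasLeadingTerm_classSum {m : SignedPerm} (hm : IsMinimal m.word) :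
    HasLeadingTerm K (classSum K m) m := by
  have hnf := SignedPerm.normalForm_of_isMinimal hm
  refine ⟨by rw [coord_classSum, if_pos rfl], fun σ hσ => ?_⟩
  rw [coord_classSum, hnf] at hσ
  have hσ' : σ.normalForm = m := by
    by_contra h
    exact hσ (if_neg h)
  rw [← hσ']
  exact σ.normalForm_eq_or_inversions_lt

theorem linearIndependent_of_hasLeadingTerm {ι : Type*} {f : ι → FQSym K} {u : ι → SignedPerm}
    (hf : ∀ i, HasLeadingTerm K (f i) (u i)) (hu : Function.Injective u) :
    LinearIndependent K f := by
  rw [linearIndependent_iff']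
  intro s c hsum
  by_contra! hcon
  obtain ⟨i, his, hi⟩ := hcon
  classical
  -- At a leading term with fewest inversions among the indices in use, no other member of the
  -- family has a nonzero coefficient.
  obtain ⟨j, hj, hmin⟩ := (s.filter fun i => c i ≠ 0).exists_min_image
    (fun i => inversions (u i).word) ⟨i, Finset.mem_filter.2 ⟨his, hi⟩⟩
  rw [Finset.mem_filter] at hj
  have h0 := congrArg ((basis K).coord (u j)) hsum
  rw [map_sum, map_zero, Finset.sum_eq_single j] at h0
  · rw [map_smul, (hf j).1, smul_eq_mul, mul_one] at h0
    exact hj.2 h0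
  · intro k hk hne
    rw [map_smul, smul_eq_mul]
    by_contra hck
    have hk0 := left_ne_zero_of_mul hck
    rcases (hf k).2 _ (right_ne_zero_of_mul hck) with h1 | h1
    · exact hne (hu h1).symm
    · have := hmin k (Finset.mem_filter.2 ⟨hk, hk0⟩)
      omega
  · exact fun h => (h hj.1).elim

/-! ### The free generators -/

/-- The indecomposable minimal signed permutations, which index the free generators. -/
abbrev Generator : Type := {m : SignedPerm // IsMinimal m.word ∧ m.IsIndecomposable}

variable (K) in
/-- The family of the free generators. -/
noncomputable def generators (g : Generator) : cambAlgebra K :=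
  ⟨classSum K g.1, classSum_mem K g.1⟩

theorem hasLeadingTerm_lift (w : FreeMonoid Generator) :
    HasLeadingTerm K (FreeMonoid.lift (generators K) w : FQSym K)
      (SignedPerm.concat (w.toList.map Subtype.val)) := by
  induction w using FreeMonoid.inductionOn' with
  | one => exact hasLeadingTerm_one
  | of_mul x w ih =>
    rw [map_mul, FreeMonoid.lift_eval_of]
    exact (hasLeadingTerm_classSum x.2.1).mul ih

theorem lift_basisFreeMonoid {ι A : Type*} [Semiring A] [Algebra K A] (x : ι → A)
    (w : FreeMonoid ι) :
    FreeAlgebra.lift K x (FreeAlgebra.basisFreeMonoid K ι w) = FreeMonoid.lift x w := by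
  have h : FreeAlgebra.basisFreeMonoid K ι w = FreeMonoid.lift (FreeAlgebra.ι K) w := by
    simp [FreeAlgebra.basisFreeMonoid, FreeAlgebra.equivMonoidAlgebraFreeMonoid]
  rw [h]
  clear h
  induction w using FreeMonoid.inductionOn' with
  | one => simp
  | of_mul x w ih =>
    simp only [map_mul, FreeMonoid.lift_eval_of, FreeAlgebra.lift_ι_apply, ih]

/-- Monomials in the generators have the concatenations of their index words as leading terms, which
are distinct by unique factorization. -/
theorem lift_generators_injective : Function.Injective (FreeAlgebra.lift K (generators K)) := by
  have hli : LinearIndependent K fun w : FreeMonoid Generator =>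
      (FreeMonoid.lift (generators K) w : FQSym K) := by
    refine linearIndependent_of_hasLeadingTerm hasLeadingTerm_lift fun w w' h => ?_
    have h' := SignedPerm.concat_injective (by simp; tauto) (by simp; tauto) h
    exact FreeMonoid.toList.injective (List.map_injective_iff.2 Subtype.val_injective h')
  let φ : FreeAlgebra K Generator →ₗ[K] FQSym K :=
    ((cambAlgebra K).val.comp (FreeAlgebra.lift K (generators K))).toLinearMap
  rw [injective_iff_map_eq_zero]
  intro a ha
  have h0 : φ a = 0 := congrArg Subtype.val ha
  rw [← (FreeAlgebra.basisFreeMonoid K Generator).linearCombination_repr a,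
    Finsupp.apply_linearCombination] at h0
  have hφ : φ ∘ FreeAlgebra.basisFreeMonoid K Generator = fun w : FreeMonoid Generator =>
      (FreeMonoid.lift (generators K) w : FQSym K) :=
    funext fun w => congrArg Subtype.val (lift_basisFreeMonoid (generators K) w)
  rw [hφ] at h0
  exact (LinearEquiv.map_eq_zero_iff _).1 (linearIndependent_iff.1 hli _ h0)

theorem inversions_le (w : List (ℕ × Bool)) : inversions w ≤ w.length * w.length := by
  induction w with
  | nil => simp [inversions]
  | cons x w ih =>
    have : w.countP (fun y => decide (y.1 < x.1)) ≤ w.length := List.countP_le_length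
    simp only [inversions, List.length_cons]
    nlinarith

/-- Triangularity: subtracting from the class sum the monomial with the same leading term leaves
class sums of the same size with more inversions. -/
theorem classSum_mem_range {m : SignedPerm} (hm : IsMinimal m.word) :
    classSum K m ∈ ((cambAlgebra K).val.comp (FreeAlgebra.lift K (generators K))).range := by
  -- Descending induction on inversions at fixed size; the bound `inversions_le` makes this measure
  -- strictly decrease.
  obtain ⟨k, hk⟩ : ∃ k, m.size * m.size - inversions m.word = k := ⟨_, rfl⟩
  induction k using Nat.strong_induction_on generalizing m with
  | _ k ih =>
    obtain ⟨l, hl, hlm⟩ := SignedPerm.exists_concat hm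
    lift l to List Generator using hl
    set g := (FreeMonoid.lift (generators K) (FreeMonoid.ofList l) : FQSym K) with hg
    have hgl : HasLeadingTerm K g m := hlm ▸ hasLeadingTerm_lift (FreeMonoid.ofList l)
    have hgr : g ∈ ((cambAlgebra K).val.comp (FreeAlgebra.lift K (generators K))).range :=
      ⟨_, congrArg Subtype.val (lift_basisFreeMonoid (generators K) (FreeMonoid.ofList l))⟩
    have hcl := hasLeadingTerm_classSum (K := K) hm
    obtain ⟨s, hs, hsum⟩ := exists_eq_sum_classSum K
      (sub_mem (classSum_mem K m) (FreeMonoid.lift (generators K) (FreeMonoid.ofList l)).2)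
    rw [← hg] at hs hsum
    rw [← sub_add_cancel (classSum K m) g, hsum]
    refine add_mem (sum_mem fun m' hm' => Subalgebra.smul_mem _ ?_ _) hgr
    obtain ⟨h1, h2⟩ := hs m' hm'
    have h3 : m'.size = m.size ∧ inversions m.word < inversions m'.word := by
      rw [map_sub] at h2
      have hne : m' ≠ m := by
        rintro rfl
        rw [hcl.1, hgl.1, sub_self] at h2
        exact h2 rfl
      by_cases h4 : (basis K).coord m' g = 0
      · rw [h4, sub_zero] at h2
        exact (hcl.2 m' h2).resolve_left hne
      · exact (hgl.2 m' h4).resolve_left hne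
    have h4 := inversions_le m'.word
    have h5 : m'.word.length = m.size := h3.1
    rw [h5] at h4
    exact ih (m'.size * m'.size - inversions m'.word) (by rw [h3.1]; omega) h1 rfl

theorem lift_generators_surjective : Function.Surjective (FreeAlgebra.lift K (generators K)) := by
  intro a
  obtain ⟨s, hs, hsum⟩ := exists_eq_sum_classSum K a.2
  have : (a : FQSym K) ∈
      ((cambAlgebra K).val.comp (FreeAlgebra.lift K (generators K))).range := by
    rw [hsum]
    exact sum_mem fun m hm => Subalgebra.smul_mem _ (classSum_mem_range (hs m hm).1) _
  obtain ⟨b, hb⟩ := this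
  exact ⟨b, Subtype.ext hb⟩

end Cambrian

namespace Cambrian

/-! ### Counting minimal signed permutations -/

/-- Whether a new largest letter may be inserted between `A` and `B` without creating a
reduction. -/
def ActiveSite (A B : List (ℕ × Bool)) : Prop :=
  ∀ y ∈ B.head?, (∀ b ∈ B, y.1 < b.1 → b.2 = true) ∧ (∀ b ∈ A, y.1 < b.1 → b.2 = false)

/-- The largest letter can only play the role of `c`, so the only new reduction to exclude swaps it
with the letter `y` right after it. -/
theorem isMinimal_insert {A B : List (ℕ × Bool)} {n : ℕ} (s : Bool)
    (hn : ∀ x ∈ A ++ B, x.1 < n) :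
    IsMinimal (A ++ (n, s) :: B) ↔ IsMinimal (A ++ B) ∧ ActiveSite A B := by
  constructor
  · intro h
    constructor
    · rintro w ⟨U, V, a, b, c, hw, -, h1, h2, h3⟩
      have hb : b ∈ A ++ B := by rw [hw]; rcases h3 with h3 | h3 <;> simp [h3.1]
      rcases List.append_eq_append_iff.1 hw with ⟨U', rfl, rfl⟩ | ⟨A', rfl, hA'⟩
      · refine h _ ⟨A ++ (n, s) :: U', V, a, b, c, by simp, rfl, h1, h2, h3.imp_right ?_⟩
        rintro ⟨h3, h4⟩
        refine ⟨?_, h4⟩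
        simp only [List.mem_append, List.mem_cons] at h3 ⊢
        tauto
      · match A', hA' with
        | [], hA' =>
          obtain rfl : c :: a :: V = B := hA'
          refine h _ ⟨U ++ [(n, s)], V, a, b, c, by simp, rfl, h1, h2, h3.imp_right ?_⟩
          exact fun h3 => ⟨by simp [h3.1], h3.2⟩
        -- The new letter separates `c` from `a`. It then takes the role of `c` itself, with the
        -- same witness `b`.
        | [_], hA' =>
          simp only [List.cons_append, List.nil_append, List.cons.injEq] at hA'
          obtain ⟨rfl, rfl⟩ := hA'
          refine h _ ⟨U ++ [c], V, a, b, (n, s), by simp, rfl, h1, hn b hb, h3.imp_right ?_⟩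
          exact fun h3 => ⟨by simp [h3.1], h3.2⟩
        | _ :: _ :: A'', hA' =>
          simp only [List.cons_append, List.cons.injEq] at hA'
          obtain ⟨rfl, rfl, rfl⟩ := hA'
          refine h _ ⟨U, A'' ++ (n, s) :: B, a, b, c, by simp, rfl, h1, h2, h3.imp_left ?_⟩
          rintro ⟨h3, h4⟩
          refine ⟨?_, h4⟩
          simp only [List.mem_append, List.mem_cons] at h3 ⊢
          tauto
    · intro y hy
      obtain ⟨V, rfl⟩ : ∃ V, B = y :: V := by
        cases B with
        | nil => simp at hy
        | cons z V => simp at hy; exact ⟨V, by rw [hy]⟩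
      constructor
      · intro b hb hyb
        by_contra hs
        have hbV : b ∈ V := (List.mem_cons.1 hb).resolve_left (by rintro rfl; omega)
        exact h _ ⟨A, V, y, b, (n, s), rfl, rfl, hyb, hn b (by simp [hbV]),
          Or.inl ⟨hbV, by simpa using hs⟩⟩
      · intro b hb hyb
        by_contra hs
        exact h _ ⟨A, V, y, b, (n, s), rfl, rfl, hyb, hn b (by simp [hb]),
          Or.inr ⟨hb, by simpa using hs⟩⟩
  · rintro ⟨h, hact⟩ w ⟨U, V, a, b, c, hw, -, h1, h2, h3⟩
    have hkey : ∀ V, B = a :: V → c = (n, s) → ((b ∈ V ∧ b.2 = false) ∨ (b ∈ A ∧ b.2 = true)) →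
        False := by
      rintro V rfl rfl h3
      have := hact a (by simp)
      rcases h3 with h3 | h3
      · have := this.1 b (by simp [h3.1]) h1
        rw [h3.2] at this; simp at this
      · have := this.2 b h3.1 h1
        rw [h3.2] at this; simp at this
    have hbn : ∀ c ∈ A ++ B, b.1 < c.1 → b ≠ (n, s) := by
      rintro c hc hbc rfl
      have := hn c hc
      simp only at hbc
      omega
    rcases List.append_eq_append_iff.1 hw with ⟨U', rfl, hU'⟩ | ⟨A', rfl, hA'⟩
    · match U', hU' with
      | [], hU' =>
        simp only [List.nil_append, List.cons.injEq] at hU'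
        exact hkey V hU'.2 hU'.1.symm (by simpa using h3)
      | _ :: U'', hU' =>
        simp only [List.cons_append, List.cons.injEq] at hU'
        obtain ⟨rfl, rfl⟩ := hU'
        refine h _ ⟨A ++ U'', V, a, b, c, by simp, rfl, h1, h2, h3.imp_right ?_⟩
        rintro ⟨h3, h4⟩
        have := hbn c (by simp) h2
        refine ⟨?_, h4⟩
        simp only [List.mem_append, List.mem_cons] at h3 ⊢
        tauto
    · match A', hA' with
      | [], hA' =>
        simp only [List.nil_append, List.cons.injEq] at hA'
        exact hkey V hA'.2.symm hA'.1 (by simpa using h3)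
      | [_], hA' =>
        simp only [List.cons_append, List.nil_append, List.cons.injEq] at hA'
        obtain ⟨rfl, rfl, rfl⟩ := hA'
        have := hn c (by simp)
        simp only at h1; omega
      | _ :: _ :: A'', hA' =>
        simp only [List.cons_append, List.cons.injEq] at hA'
        obtain ⟨rfl, rfl, rfl⟩ := hA'
        refine h _ ⟨U, A'' ++ B, a, b, c, by simp, rfl, h1, h2, h3.imp_left ?_⟩
        rintro ⟨h3, h4⟩
        have := hbn c (by simp) h2
        refine ⟨?_, h4⟩
        simp only [List.mem_append, List.mem_cons] at h3 ⊢
        tauto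

/-- An earlier site followed by an old letter survives only if the new letter is positive: a
negative one to its right would be a witness. -/
theorem activeSite_insert_right {A₁ A₂ B : List (ℕ × Bool)} {n : ℕ} (s : Bool)
    (hn : ∀ x ∈ A₂, x.1 < n) (hA : A₂ ≠ []) :
    ActiveSite A₁ (A₂ ++ (n, s) :: B) ↔ s = true ∧ ActiveSite A₁ (A₂ ++ B) := by
  obtain ⟨y, A₂, rfl⟩ := List.exists_cons_of_ne_nil hA
  have := hn y (by simp)
  simp only [ActiveSite, List.cons_append, List.head?_cons, Option.mem_some_iff, forall_eq',
    List.mem_cons, List.mem_append]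
  constructor
  · rintro ⟨h1, h2⟩
    exact ⟨h1 (n, s) (by simp) this, fun b hb => h1 b (by tauto), h2⟩
  · rintro ⟨rfl, h1, h2⟩
    refine ⟨fun b hb hyb => ?_, h2⟩
    by_cases hbn : b = (n, true)
    · rw [hbn]
    · exact h1 b (by tauto) hyb

theorem activeSite_cons_self {A B : List (ℕ × Bool)} {n : ℕ} (s : Bool)
    (hn : ∀ x ∈ A ++ B, x.1 < n) : ActiveSite A ((n, s) :: B) := by
  simp only [ActiveSite, List.head?_cons, Option.mem_some_iff, forall_eq', List.mem_cons]
  refine ⟨fun b hb hnb => ?_, fun b hb hnb => ?_⟩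
  · rcases hb with rfl | hb
    · omega
    · have := hn b (by simp [hb]); omega
  · have := hn b (by simp [hb]); omega

/-- A later site survives only if the new letter is negative, except for the end of the word, which
is always active. -/
theorem activeSite_insert_left {A B₁ B₂ : List (ℕ × Bool)} {n : ℕ} (s : Bool)
    (hn : ∀ x ∈ B₂, x.1 < n) :
    ActiveSite (A ++ (n, s) :: B₁) B₂ ↔ B₂ = [] ∨ (s = false ∧ ActiveSite (A ++ B₁) B₂) := by
  cases B₂ with
  | nil => simp [ActiveSite]
  | cons y B₂ =>
    have := hn y (by simp)
    simp only [ActiveSite, List.head?_cons, Option.mem_some_iff, forall_eq', List.mem_cons,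
      List.mem_append, reduceCtorEq, false_or]
    constructor
    · rintro ⟨h1, h2⟩
      exact ⟨h2 (n, s) (by simp) this, h1, fun b hb => h2 b (by tauto)⟩
    · rintro ⟨rfl, h1, h2⟩
      refine ⟨h1, fun b hb hyb => ?_⟩
      by_cases hbn : b = (n, false)
      · rw [hbn]
      · exact h2 b (by tauto) hyb

namespace SignedPerm

/-- Insert a new largest letter with sign `s` at position `i`. -/
def insertMax (τ : SignedPerm) (i : ℕ) (s : Bool) : SignedPerm where
  word := τ.word.take i ++ (τ.size, s) :: τ.word.drop i
  perm := by
    have h : (τ.word.take i ++ (τ.size, s) :: τ.word.drop i).Perm ((τ.size, s) :: τ.word) := by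
      refine List.perm_middle.trans (List.Perm.of_eq ?_)
      rw [List.take_append_drop]
    rw [h.length_eq, List.length_cons, List.range_succ]
    refine (h.map _).trans ?_
    rw [List.map_cons]
    exact (τ.perm.cons _).trans (List.perm_append_singleton _ _).symm

open Classical in
/-- The positions at which a new largest letter may be inserted. -/
noncomputable def sites (τ : SignedPerm) : Finset ℕ :=
  (Finset.range (τ.size + 1)).filter fun i => ActiveSite (τ.word.take i) (τ.word.drop i)

theorem mem_sites {τ : SignedPerm} {i : ℕ} :
    i ∈ τ.sites ↔ i ≤ τ.size ∧ ActiveSite (τ.word.take i) (τ.word.drop i) := by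
  simp [sites]

theorem size_insertMax (τ : SignedPerm) (i : ℕ) (s : Bool) :
    (τ.insertMax i s).size = τ.size + 1 := by
  have h := List.take_append_drop i τ.word
  have := congrArg List.length h
  simp only [size, insertMax, List.length_append, List.length_cons] at this ⊢
  omega

theorem isMinimal_insertMax {τ : SignedPerm} {i : ℕ} (s : Bool) :
    IsMinimal (τ.insertMax i s).word ↔
      IsMinimal τ.word ∧ ActiveSite (τ.word.take i) (τ.word.drop i) := by
  have := isMinimal_insert (A := τ.word.take i) (B := τ.word.drop i) (n := τ.size) s
    (by rw [List.take_append_drop]; exact τ.fst_lt)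
  rwa [List.take_append_drop] at this

theorem mem_sites_insertMax_of_le {τ : SignedPerm} {i j : ℕ} (s : Bool) (hi : i ≤ τ.size)
    (hj : j ≤ i) : j ∈ (τ.insertMax i s).sites ↔ j = i ∨ (s = true ∧ j ∈ τ.sites) := by
  rw [mem_sites, mem_sites, size_insertMax]
  have hlen : (τ.word.take i).length = i := List.length_take_of_le hi
  simp only [insertMax]
  rw [List.take_append_of_le_length (by omega), List.drop_append_of_le_length (by omega),
    List.take_take, min_eq_left hj]
  rcases hj.eq_or_lt with rfl | hj
  · have : ActiveSite (τ.word.take j) ((τ.size, s) :: τ.word.drop j) :=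
      activeSite_cons_self s (by rw [List.take_append_drop]; exact τ.fst_lt)
    rw [List.drop_of_length_le (by omega), List.nil_append]
    simp [this]; omega
  · rw [activeSite_insert_right s (fun x hx => τ.fst_lt x
      (List.mem_of_mem_take (List.mem_of_mem_drop hx)))
      (by intro h; have := congrArg List.length h; simp at this; unfold size at hi; omega)]
    have : (τ.word.take i).drop j ++ τ.word.drop i = τ.word.drop j := by
      conv_rhs => rw [← List.take_append_drop i τ.word,
        List.drop_append_of_le_length (by omega)]
    rw [this]
    constructor
    · rintro ⟨-, h1, h2⟩
      exact Or.inr ⟨h1, by omega, h2⟩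
    · rintro (h | ⟨h1, h2, h3⟩)
      · omega
      · exact ⟨by omega, h1, h3⟩

/-- Positions after the new letter are shifted by one, so the old site `i` corresponds both to `i`,
just before that letter, and to `i + 1`, just after it. -/
theorem mem_sites_insertMax_of_ge {τ : SignedPerm} {i j : ℕ} (s : Bool) (hi : i ≤ j)
    (hj : j ≤ τ.size) :
    j + 1 ∈ (τ.insertMax i s).sites ↔ j = τ.size ∨ (s = false ∧ j ∈ τ.sites) := by
  rw [mem_sites, mem_sites, size_insertMax]
  have hlen : (τ.word.take i).length = i := List.length_take_of_le (hi.trans hj)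
  obtain ⟨k, rfl⟩ := Nat.exists_eq_add_of_le hi
  have h1 : (τ.insertMax i s).word.take (i + k + 1) =
      τ.word.take i ++ (τ.size, s) :: (τ.word.drop i).take k := by
    simp only [insertMax]
    rw [List.take_append, hlen, List.take_of_length_le (by omega),
      show i + k + 1 - i = k + 1 by omega, List.take_succ_cons]
  have h2 : (τ.insertMax i s).word.drop (i + k + 1) = τ.word.drop (i + k) := by
    simp only [insertMax]
    rw [List.drop_append, hlen, List.drop_of_length_le (by omega),
      show i + k + 1 - i = k + 1 by omega, List.drop_succ_cons, List.drop_drop, List.nil_append]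
  rw [h1, h2, activeSite_insert_left s fun x hx => τ.fst_lt x (List.mem_of_mem_drop hx),
    ← List.take_add, List.drop_eq_nil_iff]
  have : τ.word.length = τ.size := rfl
  rw [this]
  constructor
  · rintro ⟨-, h | h⟩
    · left; omega
    · exact Or.inr ⟨h.1, hj, h.2⟩
  · rintro (h | ⟨h1, h2, h3⟩)
    · exact ⟨by omega, Or.inl h.ge⟩
    · exact ⟨by omega, Or.inr ⟨h1, h3⟩⟩

/-- A negative letter closes the sites before `i`. It keeps those from `i` on, shifted by one, and
adds the site just before itself. -/
theorem card_sites_insertMax_false {τ : SignedPerm} {i : ℕ} (hi : i ∈ τ.sites) :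
    (τ.insertMax i false).sites.card = (τ.sites.filter fun j => i ≤ j).card + 1 := by
  have hi' := (mem_sites.1 hi).1
  have hlast : τ.size ∈ τ.sites := mem_sites.2 ⟨le_rfl, by
    rw [List.drop_of_length_le (show τ.word.length ≤ τ.size from le_rfl)]
    simp [ActiveSite]⟩
  have : (τ.insertMax i false).sites =
      insert i ((τ.sites.filter fun j => i ≤ j).map ⟨Nat.succ, Nat.succ_injective⟩) := by
    ext j
    simp only [Finset.mem_insert, Finset.mem_map, Finset.mem_filter, Function.Embedding.coeFn_mk]
    rcases le_or_gt j i with h | h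
    · rw [mem_sites_insertMax_of_le false hi' h]
      constructor
      · rintro (h | h)
        · exact Or.inl h
        · simp at h
      · rintro (h | ⟨k, ⟨-, hk⟩, hk'⟩)
        · exact Or.inl h
        · omega
    · obtain ⟨k, rfl⟩ : ∃ k, j = k + 1 := ⟨j - 1, by omega⟩
      by_cases hk : k ≤ τ.size
      · rw [mem_sites_insertMax_of_ge false (by omega) hk]
        constructor
        · rintro (rfl | h)
          · exact Or.inr ⟨_, ⟨hlast, hi'⟩, rfl⟩
          · exact Or.inr ⟨k, ⟨h.2, by omega⟩, rfl⟩
        · rintro (h | ⟨k', ⟨h1, -⟩, h2⟩)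
          · omega
          · obtain rfl : k' = k := Nat.succ_injective h2
            exact Or.inr ⟨rfl, h1⟩
      · constructor
        · intro h
          have := (mem_sites.1 h).1
          rw [size_insertMax] at this
          omega
        · rintro (h | ⟨k', ⟨h1, -⟩, h2⟩)
          · omega
          · have := (mem_sites.1 h1).1
            omega
  rw [this, Finset.card_insert_of_notMem, Finset.card_map]
  simp only [Finset.mem_map, Finset.mem_filter, Function.Embedding.coeFn_mk, not_exists, not_and]
  rintro k ⟨-, hk⟩
  omega

/-- A positive letter keeps the sites before `i`. After that only the site just before it and the
end of the word remain. -/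
theorem card_sites_insertMax_true {τ : SignedPerm} {i : ℕ} (hi : i ∈ τ.sites) :
    (τ.insertMax i true).sites.card = (τ.sites.filter fun j => j < i).card + 2 := by
  have hi' := (mem_sites.1 hi).1
  have : (τ.insertMax i true).sites =
      insert (τ.size + 1) (insert i (τ.sites.filter fun j => j < i)) := by
    ext j
    simp only [Finset.mem_insert, Finset.mem_filter]
    rcases le_or_gt j i with h | h
    · rw [mem_sites_insertMax_of_le true hi' h]
      constructor
      · rintro (h' | h')
        · exact Or.inr (Or.inl h')
        · rcases h.eq_or_lt with h | h
          · exact Or.inr (Or.inl h)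
          · exact Or.inr (Or.inr ⟨h'.2, h⟩)
      · rintro (h | h | h)
        · omega
        · exact Or.inl h
        · exact Or.inr ⟨rfl, h.1⟩
    · obtain ⟨k, rfl⟩ : ∃ k, j = k + 1 := ⟨j - 1, by omega⟩
      by_cases hk : k ≤ τ.size
      · rw [mem_sites_insertMax_of_ge true (by omega) hk]
        constructor
        · rintro (rfl | h)
          · exact Or.inl rfl
          · simp at h
        · rintro (h | h | h)
          · left; omega
          · omega
          · omega
      · constructor
        · intro h
          have := (mem_sites.1 h).1
          rw [size_insertMax] at this
          omega
        · rintro (h | h | h) <;> omega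
  rw [this, Finset.card_insert_of_notMem, Finset.card_insert_of_notMem]
  · simp
  · simp; omega

/-- Removing the largest letter. -/
theorem exists_insertMax {σ : SignedPerm} {n : ℕ} (hσ : σ.size = n + 1) :
    ∃ τ i s, τ.size = n ∧ i ≤ n ∧ σ = insertMax τ i s := by
  obtain ⟨⟨x, s⟩, hx, rfl⟩ := List.mem_map.1 ((σ.mem_values_iff n).2 (by omega))
  obtain ⟨A, B, hAB⟩ := List.append_of_mem hx
  have hlo : (σ.lo x).word = A ++ B := by
    have h1 : ∀ y ∈ A ++ B, y.1 < x := by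
      intro y hy
      have hy' : y ∈ σ.word := by rw [hAB]; simp at hy ⊢; tauto
      have h2 := σ.fst_lt y hy'
      have h3 : y.1 ≠ x := by
        intro he
        have := σ.nodup_values
        rw [hAB, List.map_append, List.map_cons, List.nodup_middle, List.nodup_cons,
          ← List.map_append] at this
        exact this.1 (List.mem_map.2 ⟨y, hy, he⟩)
      simp only at hσ
      omega
    simp only [lo, hAB, List.filter_append, List.filter_cons, lt_irrefl, decide_false,
      Bool.false_eq_true, if_false]
    rw [← List.filter_append, List.filter_eq_self]
    simpa using h1
  simp only at hσ
  have hs : (σ.lo x).size = x := size_lo (by omega)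
  have hlen : A.length ≤ x := by
    rw [← hs, size, hlo]; simp
  refine ⟨σ.lo x, A.length, s, hs, hlen, word_injective ?_⟩
  simp [hAB, insertMax, hs, hlo]

theorem insertMax_inj {τ τ' : SignedPerm} {i i' : ℕ} {s s' : Bool} (hs : τ.size = τ'.size)
    (hi : i ≤ τ.size) (hi' : i' ≤ τ'.size) (h : τ.insertMax i s = τ'.insertMax i' s') :
    τ = τ' ∧ i = i' ∧ s = s' := by
  have hlo : ∀ (τ : SignedPerm) (i : ℕ) (s : Bool), (τ.insertMax i s).lo τ.size = τ := by
    intro τ i s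
    apply word_injective
    simp only [lo, insertMax, List.filter_append, List.filter_cons, lt_irrefl, decide_false,
      Bool.false_eq_true, if_false]
    rw [← List.filter_append, List.take_append_drop, List.filter_eq_self]
    simpa using τ.fst_lt
  have hidx : ∀ (τ : SignedPerm) (i : ℕ) (s : Bool), i ≤ τ.size →
      ((τ.insertMax i s).word.map Prod.fst).idxOf τ.size = i := by
    intro τ i s hi
    simp only [insertMax, List.map_append, List.map_cons]
    rw [List.idxOf_append_of_notMem]
    · rw [List.idxOf_cons_self, List.length_map, List.length_take_of_le hi, add_zero]
    · rw [List.mem_map]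
      rintro ⟨x, hx, hx'⟩
      have := τ.fst_lt x (List.mem_of_mem_take hx)
      omega
  obtain rfl : τ = τ' := by
    rw [← hlo τ i s, h, hs, hlo]
  obtain rfl : i = i' := by
    rw [← hidx τ i s hi, h, hidx τ i' s' hi']
  refine ⟨rfl, rfl, ?_⟩
  have h1 : (τ.size, s) ∈ (τ.insertMax i s).word := by simp [insertMax]
  have h2 : (τ.size, s') ∈ (τ.insertMax i s).word := by rw [h]; simp [insertMax]
  exact congrArg Prod.snd (eq_of_fst_eq _ h1 h2 rfl)

end SignedPerm
end Cambrian

/-! ### Catalan enumeration of minimal and indecomposable permutations -/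

namespace Cambrian

/-- The number of smaller elements is the rank of `i` in `s`, which takes each value below the
cardinality once. -/
theorem sum_card_filter_lt (s : Finset ℕ) (φ : ℕ → ℕ) :
    ∑ i ∈ s, φ (s.filter fun j => j < i).card = ∑ r ∈ Finset.range s.card, φ r := by
  induction s using Finset.induction_on_max with
  | empty => simp
  | insert a s hmax ih =>
    have ha : a ∉ s := fun h => lt_irrefl _ (hmax a h)
    rw [Finset.sum_insert ha, Finset.card_insert_of_notMem ha, Finset.sum_range_succ, add_comm,
      ← ih]
    congr 1
    · refine Finset.sum_congr rfl fun i hi => ?_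
      rw [Finset.filter_insert, if_neg (hmax i hi).not_gt]
    · rw [Finset.filter_insert, if_neg (lt_irrefl a), Finset.filter_true_of_mem hmax]

theorem sum_card_filter_ge (s : Finset ℕ) (φ : ℕ → ℕ) :
    ∑ i ∈ s, φ (s.filter fun j => i ≤ j).card = ∑ r ∈ Finset.range s.card, φ (r + 1) := by
  induction s using Finset.induction_on_min with
  | empty => simp
  | insert a s hmin ih =>
    have ha : a ∉ s := fun h => lt_irrefl _ (hmin a h)
    rw [Finset.sum_insert ha, Finset.card_insert_of_notMem ha, Finset.sum_range_succ, add_comm,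
      ← ih]
    congr 1
    · refine Finset.sum_congr rfl fun i hi => ?_
      rw [Finset.filter_insert, if_neg (hmin i hi).not_ge]
    · rw [Finset.filter_insert, if_pos le_rfl, Finset.filter_true_of_mem fun i hi => (hmin i hi).le,
        Finset.card_insert_of_notMem ha]

namespace SignedPerm

open Classical in
/-- The minimal signed permutations of size `n`. -/
noncomputable def minimals (n : ℕ) : Finset SignedPerm :=
  (finite_size_eq n).toFinset.filter fun τ => IsMinimal τ.word

theorem mem_minimals {n : ℕ} {τ : SignedPerm} :
    τ ∈ minimals n ↔ τ.size = n ∧ IsMinimal τ.word := by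
  simp [minimals]

theorem minimals_zero : minimals 0 = {.empty} := by
  ext τ
  rw [mem_minimals, Finset.mem_singleton, size_eq_zero_iff]
  constructor
  · exact And.left
  · rintro rfl; exact ⟨rfl, isMinimal_empty⟩

theorem card_sites_empty : SignedPerm.empty.sites.card = 1 := by
  have : SignedPerm.empty.sites = {0} := by
    ext i
    rw [mem_sites, Finset.mem_singleton]
    constructor
    · rintro ⟨h, -⟩; exact Nat.le_zero.1 h
    · rintro rfl; exact ⟨le_rfl, by simp [ActiveSite, empty]⟩
  rw [this, Finset.card_singleton]

/-- The generating tree of minimal signed permutations has twice the Catalan succession rule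
`(k) → (2)(3)⋯(k+1)`. -/
theorem sum_minimals_succ (n : ℕ) (φ : ℕ → ℕ) :
    ∑ σ ∈ minimals (n + 1), φ σ.sites.card =
      2 * ∑ τ ∈ minimals n, ∑ r ∈ Finset.range τ.sites.card, φ (r + 2) := by
  have h1 : ∑ σ ∈ minimals (n + 1), φ σ.sites.card =
      ∑ x ∈ (minimals n).sigma fun τ => τ.sites ×ˢ (Finset.univ : Finset Bool),
        φ (x.1.insertMax x.2.1 x.2.2).sites.card := by
    symm
    refine Finset.sum_bij (fun x _ => x.1.insertMax x.2.1 x.2.2) ?_ ?_ ?_ ?_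
    · rintro ⟨τ, i, s⟩ hx
      simp only [Finset.mem_sigma, Finset.mem_product, Finset.mem_univ, and_true, mem_minimals,
        mem_sites] at hx ⊢
      rw [size_insertMax, isMinimal_insertMax]
      exact ⟨by omega, hx.1.2, hx.2.2⟩
    · rintro ⟨τ, i, s⟩ hx ⟨τ', i', s'⟩ hx' h
      simp only [Finset.mem_sigma, Finset.mem_product, Finset.mem_univ, and_true, mem_minimals,
        mem_sites] at hx hx'
      obtain ⟨rfl, rfl, rfl⟩ := insertMax_inj (by omega) hx.2.1 hx'.2.1 h
      rfl
    · intro σ hσ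
      rw [mem_minimals] at hσ
      obtain ⟨τ, i, s, hτ, hi, rfl⟩ := exists_insertMax hσ.1
      rw [isMinimal_insertMax] at hσ
      refine ⟨⟨τ, i, s⟩, ?_, rfl⟩
      simp only [Finset.mem_sigma, Finset.mem_product, Finset.mem_univ, and_true, mem_minimals,
        mem_sites]
      exact ⟨⟨hτ, hσ.2.1⟩, by omega, hσ.2.2⟩
    · intro _ _; rfl
  rw [h1, Finset.sum_sigma, Finset.mul_sum]
  refine Finset.sum_congr rfl fun τ _ => ?_
  rw [Finset.sum_product]
  simp only [Fintype.sum_bool, Finset.sum_add_distrib]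
  have h2 : ∑ i ∈ τ.sites, φ (τ.insertMax i true).sites.card =
      ∑ r ∈ Finset.range τ.sites.card, φ (r + 2) := by
    rw [← sum_card_filter_lt τ.sites fun k => φ (k + 2)]
    exact Finset.sum_congr rfl fun i hi => by rw [card_sites_insertMax_true hi]
  have h3 : ∑ i ∈ τ.sites, φ (τ.insertMax i false).sites.card =
      ∑ r ∈ Finset.range τ.sites.card, φ (r + 2) := by
    rw [← sum_card_filter_ge τ.sites fun k => φ (k + 1)]
    exact Finset.sum_congr rfl fun i hi => by rw [card_sites_insertMax_false hi]
  rw [h2, h3]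
  ring

end SignedPerm

open PowerSeries in
-- Multiply `C = 1 + X C²` by `C ^ k` and telescope. Thus the coefficients of `C ^ k` obey the
-- succession rule `(k) → (2)⋯(k+1)`.
theorem coeff_catalanSeries_pow_succ (n k : ℕ) :
    coeff (n + 1) (catalanSeries ^ k) =
      ∑ r ∈ Finset.range k, coeff n (catalanSeries ^ (r + 2)) := by
  induction k with
  | zero => simp [coeff_one]
  | succ k ih =>
    rw [Finset.sum_range_succ, ← ih, pow_succ]
    nth_rewrite 2 [← catalanSeries_sq_mul_X_add_one]
    rw [mul_add, mul_one, map_add, ← mul_assoc, coeff_succ_mul_X, ← pow_add, add_comm]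

namespace SignedPerm

open PowerSeries in
-- The coefficient of index `j` in `C ^ k` counts the descendants of a node `(k)` after `j`
-- generations of the undoubled Catalan rule. Summing over generation `n` thus trades one generation
-- for one index and a factor `2`, down to the root `(1)`.
theorem sum_minimals_coeff (n j : ℕ) :
    ∑ σ ∈ minimals n, coeff j (catalanSeries ^ σ.sites.card) = 2 ^ n * catalan (n + j) := by
  induction n generalizing j with
  | zero => simp [minimals_zero, card_sites_empty, catalanSeries]
  | succ n ih =>
    rw [sum_minimals_succ n fun k => coeff j (catalanSeries ^ k)]
    simp only [← coeff_catalanSeries_pow_succ]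
    rw [ih, pow_succ, show n + (j + 1) = n + 1 + j by omega]
    ring

open PowerSeries in
theorem card_minimals (n : ℕ) : (minimals n).card = 2 ^ n * catalan n := by
  have h := sum_minimals_coeff n 0
  have h1 : ∀ k, coeff 0 (catalanSeries ^ k) = 1 := by
    intro k
    rw [PowerSeries.coeff_zero_eq_constantCoeff_apply, map_pow]
    simp
  simpa [h1] using h

open Classical in
/-- The indecomposable minimal signed permutations of size `n`. -/
noncomputable def indecomposables (n : ℕ) : Finset SignedPerm :=
  (minimals n).filter IsIndecomposable

theorem mem_indecomposables {n : ℕ} {τ : SignedPerm} :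
    τ ∈ indecomposables n ↔ (τ.size = n ∧ IsMinimal τ.word) ∧ τ.IsIndecomposable := by
  simp [indecomposables, mem_minimals]

/-- Split off the indecomposable first factor, of size `i + 1`; both it and the rest are minimal,
and they are uniquely determined. -/
theorem card_minimals_succ (n : ℕ) : (minimals (n + 1)).card =
    ∑ i ∈ Finset.range (n + 1), (indecomposables (i + 1)).card * (minimals (n - i)).card := by
  simp only [← Finset.card_product]
  rw [← Finset.card_sigma]
  symm
  refine Finset.card_bij (fun x _ => x.2.1.append x.2.2) ?_ ?_ ?_
  · rintro ⟨i, u, v⟩ hx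
    simp only [Finset.mem_sigma, Finset.mem_range, Finset.mem_product, mem_indecomposables,
      mem_minimals] at hx ⊢
    rw [size_append, isMinimal_append]
    exact ⟨by omega, hx.2.1.1.2, hx.2.2.2⟩
  · rintro ⟨i, u, v⟩ hx ⟨i', u', v'⟩ hx' h
    simp only [Finset.mem_sigma, Finset.mem_range, Finset.mem_product, mem_indecomposables,
      mem_minimals] at hx hx'
    obtain ⟨rfl, rfl⟩ := append_inj_of_indecomposable hx.2.1.2 hx'.2.1.2 h
    obtain rfl : i = i' := by omega
    rfl
  · intro m hm
    rw [mem_minimals] at hm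
    have hm0 : m ≠ .empty := by
      rintro rfl
      have : SignedPerm.empty.size = 0 := rfl
      omega
    obtain ⟨u, v, hu, rfl⟩ := exists_indecomposable_append hm0
    rw [size_append, isMinimal_append] at hm
    have hu0 : u.size ≠ 0 := fun h => hu.1 (eq_empty_of_size h)
    refine ⟨⟨u.size - 1, u, v⟩, ?_, rfl⟩
    simp only [Finset.mem_sigma, Finset.mem_range, Finset.mem_product, mem_indecomposables,
      mem_minimals]
    exact ⟨by omega, ⟨⟨by omega, hm.2.1⟩, hu⟩, by omega, hm.2.2⟩

/-- Compare with the Catalan recurrence: the terms below the top one agree by induction, so the top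
terms agree as well. -/
theorem card_indecomposables (n : ℕ) :
    (indecomposables (n + 1)).card = 2 ^ (n + 1) * catalan n := by
  induction n using Nat.strong_induction_on with
  | _ n ih =>
    have h := card_minimals_succ n
    rw [Finset.sum_range_succ, Nat.sub_self, minimals_zero, Finset.card_singleton, mul_one,
      card_minimals, catalan_succ, Fin.sum_univ_eq_sum_range (fun i => catalan i * catalan (n - i))
        n.succ, Finset.sum_range_succ, Nat.sub_self, catalan_zero, mul_one, mul_add] at h
    have h2 : ∑ i ∈ Finset.range n, (indecomposables (i + 1)).card * (minimals (n - i)).card =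
        2 ^ (n + 1) * ∑ i ∈ Finset.range n, catalan i * catalan (n - i) := by
      rw [Finset.mul_sum]
      refine Finset.sum_congr rfl fun i hi => ?_
      rw [Finset.mem_range] at hi
      rw [ih i hi, card_minimals, show n + 1 = (i + 1) + (n - i) by omega, pow_add]
      ring
    omega

end SignedPerm

/-- The generators correspond to the index set of the main theorem, by degree. -/
theorem exists_equiv_generator :
    ∃ e : (Σ n : ℕ, Fin (2 ^ (n + 1) * catalan n)) ≃ Generator,
      ∀ g, (e g).1.size = g.1 + 1 := by
  have e : ∀ n : ℕ, Nonempty (Fin (2 ^ (n + 1) * catalan n) ≃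
      SignedPerm.indecomposables (n + 1)) := fun n =>
    ⟨(finCongr (SignedPerm.card_indecomposables n).symm).trans
      (SignedPerm.indecomposables (n + 1)).equivFin.symm⟩
  replace e := fun n => (e n).some
  have hpos : ∀ g : Generator, g.1.size ≠ 0 := fun g h =>
    g.2.2.1 (SignedPerm.eq_empty_of_size h)
  refine ⟨Equiv.ofBijective (fun g => ⟨(e g.1 g.2).1,
    (SignedPerm.mem_indecomposables.1 (e g.1 g.2).2).1.2,
    (SignedPerm.mem_indecomposables.1 (e g.1 g.2).2).2⟩) ⟨?_, ?_⟩, ?_⟩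
  · rintro ⟨n, i⟩ ⟨m, j⟩ h
    have h' : (e n i).1 = (e m j).1 := congrArg Subtype.val h
    have h1 := (SignedPerm.mem_indecomposables.1 (e n i).2).1.1
    have h2 := (SignedPerm.mem_indecomposables.1 (e m j).2).1.1
    obtain rfl : n = m := by
      rw [h', h2] at h1; omega
    rw [(e n).injective (Subtype.ext h')]
  · intro g
    obtain ⟨n, hn⟩ : ∃ n, g.1.size = n + 1 := ⟨g.1.size - 1, by have := hpos g; omega⟩
    refine ⟨⟨n, (e n).symm ⟨g.1, SignedPerm.mem_indecomposables.2 ⟨⟨hn, g.2.1⟩, g.2.2⟩⟩⟩, ?_⟩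
    simp
  · intro g
    exact (SignedPerm.mem_indecomposables.1 (e g.1 g.2).2).1.1

theorem lift_comp_equiv_bijective {K A ι κ : Type*} [Field K] [Ring A] [Algebra K A] (e : ι ≃ κ)
    {x : κ → A} (hx : Function.Bijective (FreeAlgebra.lift K x)) :
    Function.Bijective (FreeAlgebra.lift K fun i => x (e i)) := by
  let E : FreeAlgebra K ι ≃ₐ[K] FreeAlgebra K κ := AlgEquiv.ofAlgHom
    (FreeAlgebra.lift K (FreeAlgebra.ι K ∘ e)) (FreeAlgebra.lift K (FreeAlgebra.ι K ∘ e.symm))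
    (by ext; simp) (by ext; simp)
  have hE : FreeAlgebra.lift K (fun i => x (e i)) = (FreeAlgebra.lift K x).comp E.toAlgHom := by
    ext; simp [E]
  rw [hE]
  exact hx.comp E.bijective

end Cambrian

theorem mainTheorem8 (K : Type*) [Field K] :
    ∃ A : Subalgebra K (Cambrian.FQSym K),
      Subalgebra.toSubmodule A = Cambrian.Camb K ∧
      ∃ x : (Σ n : ℕ, Fin (2 ^ (n + 1) * catalan n)) → A,
        (∀ g, (x g : Cambrian.FQSym K) ∈ Cambrian.FQSym.homogeneous K (g.1 + 1)) ∧
        Function.Bijective (FreeAlgebra.lift K x) := by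
  obtain ⟨e, he⟩ := Cambrian.exists_equiv_generator
  refine ⟨Cambrian.cambAlgebra K, Cambrian.toSubmodule_cambAlgebra K,
    fun g => Cambrian.generators K (e g), fun g => ?_, ?_⟩
  · rw [← he g]
    exact Cambrian.classSum_mem_homogeneous K _
  · exact Cambrian.lift_comp_equiv_bijective e
      ⟨Cambrian.lift_generators_injective, Cambrian.lift_generators_surjective⟩
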